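/- Let $n\ge 3$ and $2\le k\le n$. Let $F_n$ be the free group on $x_1,\dots,x_n$, and let products in $\mathrm{Aut}(F_n)$ be given by $(\varphi\psi)(x)=\varphi(\psi(x))$. For a group $G$ let $\Gamma^1(G)=G$, $\Gamma^{p+1}(G)=[\Gamma^p(G),G]$, and let $gr_*^{DCS}(G)=\bigoplus_{p\ge1}\Gamma^p(G)/\Gamma^{p+1}(G)$ be the associated Lie algebra over $\mathbb Z$, with bracket induced by the commutator. Let $IA_n$ be the group of automorphisms of $F_n$ inducing the identity on $H_1(F_n)$, and let $J_n^s$ be the group of automorphisms of $F_n$ inducing the identity on $F_n/\Gamma^{s+1}(F_n)$, so that $IA_n=J_n^1\supseteq J_n^2\supseteq\cdots$; let $gr_*^J(IA_n)=\bigoplus_{s\ge1}J_n^s/J_n^{s+1}$, a Lie algebra with bracket induced by the commutator. For $i\ne j$ let $\alpha_{i,j}\in IA_n$ be the automorphism with $x_i\mapsto x_jx_ix_j^{-1}$ and $x_r\mapsto x_r$ for $r\neq i$. Let $P\Sigma_n^+=\langle \alpha_{i,j} : 1\le j<i\le n\rangle\subseteq IA_n$. For $k\le m\le n$ let $G(n,m,k-1)$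 be the subgroup of $P\Sigma_n^+$ generated by $\alpha_{m,1},\dots,\alpha_{m,k-1}$, and let $$H(n,k)=G(n,k,k-1)\times G(n,k+1,k-1)\times\cdots\times G(n,n,k-1).$$ These $n-k+1$ subgroups commute with each other elementwise, so their inclusions define a homomorphism $\Theta(n,k):H(n,k)\to P\Sigma_n^+$. Let $V_n$ be the free abelian group on $x_1,\dots,x_n$, let $L[V_n]=\bigoplus_{s\ge1}L_s[V_n]$ be the free Lie algebra over $\mathbb Z$ on $V_n$, and let $Der(L[V_n])=\bigoplus_{s\ge1}Der_s(L[V_n])$, where $Der_s(L[V_n])\cong Hom(V_n,L_{s+1}[V_n])$ is the group of derivations that raise degree by $s$, with bracket $[D,D']=DD'-D'D$. Then: 1. The canonical morphism of Lie algebras $L[V_n]\to gr_*^{DCS}(F_n)$, sending $x_i$ to the class of $x_i$ in $\Gamma^1(F_n)/\Gamma^2(F_n)$, is an isomorphism; use it to identify the two. 2. There is a morphism of Lie algebras $J: gr_*^J(IA_n)\to Der(L[V_n])$ given by the Johnson homomorphisms, that is, for $\varphi\in J_n^s$ the derivation $J(\varphi J_n^{s+1})$ sends $x_i$ to the class of $\varphi(x_i)x_i^{-1}$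 in $\Gamma^{s+1}(F_n)/\Gamma^{s+2}(F_n)=L_{s+1}[V_n]$, for all $s\ge 1$ and all $i$. (These values determine $J$.) 3. The composite homomorphism $H(n,k)\xrightarrow{\Theta(n,k)}P\Sigma_n^+\hookrightarrow IA_n$ induces a morphism of Lie algebras $$\gamma:\ gr_*^{DCS}(H(n,k))\to gr_*^{DCS}(P\Sigma_n^+)\to gr_*^J(IA_n)\xrightarrow{\ J\ }Der(L[V_n]).$$ This morphism $\gamma$ is injective, and it is a split monomorphism of abelian groups: there is a homomorphism of abelian groups $\rho:Der(L[V_n])\to gr_*^{DCS}(H(n,k))$ with $\rho\circ\gamma=\mathrm{id}$. -/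

import Mathlib

open scoped commutatorElement

/-! ### The graded Lie ring of a strongly central filtration -/

/-- A strongly central filtration `G = G₁ ≥ G₂ ≥ G₃ ≥ ⋯` of a group `G`:
a descending sequence of subgroups with `[G_p, G_q] ≤ G_{p+q}`. -/
structure CentralFiltration (G : Type*) [Group G] where
  sub : ℕ+ → Subgroup G
  sub_one : sub 1 = ⊤
  sub_succ_le : ∀ p, sub (p + 1) ≤ sub p
  commutator_le : ∀ p q, ⁅sub p, sub q⁆ ≤ sub (p + q)

namespace CentralFiltration

variable {G : Type*} [Group G] (N : CentralFiltration G)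

theorem comm_mem {p q : ℕ+} {x y : G} (hx : x ∈ N.sub p) (hy : y ∈ N.sub q) :
    ⁅x, y⁆ ∈ N.sub (p + q) :=
  N.commutator_le p q (Subgroup.commutator_mem_commutator hx hy)

theorem le_of_le {p q : ℕ+} (h : p ≤ q) : N.sub q ≤ N.sub p := by
  induction q using PNat.recOn with
  | one => rw [le_antisymm h (one_le)]
  | succ q ih =>
    rcases h.lt_or_eq with h | h
    · exact (N.sub_succ_le q).trans (ih (PNat.lt_add_one_iff.1 h))
    · rw [h]

instance sub_normal (p : ℕ+) : (N.sub p).Normal where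
  conj_mem x hx g := by
    have h : ⁅g, x⁆ ∈ N.sub p := by
      have h1 := N.comm_mem (p := 1) (q := p) (x := g) (y := x) (by simp [N.sub_one]) hx
      exact N.le_of_le (PNat.lt_add_left p 1).le h1
    simpa [commutatorElement_def] using (N.sub p).mul_mem h hx

/-- The graded piece `G_p / G_{p+1}`, written additively. -/
def Piece (p : ℕ+) : Type _ := Additive (N.sub p ⧸ (N.sub (p + 1)).subgroupOf (N.sub p))

instance (p : ℕ+) : AddGroup (N.Piece p) :=
  inferInstanceAs (AddGroup (Additive (N.sub p ⧸ (N.sub (p + 1)).subgroupOf (N.sub p))))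

/-- The class in `G_p / G_{p+1}` of an element of `G_p`. -/
def toPiece (p : ℕ+) (g : N.sub p) : N.Piece p := Additive.ofMul (QuotientGroup.mk g)

theorem toPiece_mul (p : ℕ+) (g h : N.sub p) :
    N.toPiece p (g * h) = N.toPiece p g + N.toPiece p h := rfl

theorem toPiece_surjective (p : ℕ+) : Function.Surjective (N.toPiece p) :=
  QuotientGroup.mk_surjective

theorem toPiece_eq_iff {p : ℕ+} {g h : N.sub p} :
    N.toPiece p g = N.toPiece p h ↔ (g : G)⁻¹ * h ∈ N.sub (p + 1) :=
  QuotientGroup.eq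

theorem toPiece_eq_zero_iff {p : ℕ+} {g : N.sub p} :
    N.toPiece p g = 0 ↔ (g : G) ∈ N.sub (p + 1) :=
  QuotientGroup.eq_one_iff (N := (N.sub (p + 1)).subgroupOf (N.sub p)) g

instance (p : ℕ+) : AddCommGroup (N.Piece p) where
  add_comm a b := by
    obtain ⟨x, rfl⟩ := N.toPiece_surjective p a
    obtain ⟨y, rfl⟩ := N.toPiece_surjective p b
    rw [← toPiece_mul, ← toPiece_mul, toPiece_eq_iff]
    have h := N.comm_mem ((N.sub p).inv_mem y.2) ((N.sub p).inv_mem x.2)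
    have h2 := N.le_of_le (add_le_add_right (one_le) p) h
    simpa [commutatorElement_def, mul_assoc] using h2

theorem toPiece_conj (p : ℕ+) (x : G) (g : N.sub p) (h : x * g * x⁻¹ ∈ N.sub p) :
    N.toPiece p ⟨x * g * x⁻¹, h⟩ = N.toPiece p g := by
  rw [toPiece_eq_iff]
  have h := N.comm_mem (p := 1) (q := p) (x := x) (y := (g : G)⁻¹) (by simp [N.sub_one])
    ((N.sub p).inv_mem g.2)
  rw [add_comm] at h
  simpa [commutatorElement_def, mul_assoc] using h

/-- The map `(x, y) ↦ [x, y]` from `G_p × G_q` to `G_{p+q} / G_{p+q+1}`. -/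
def commClass (p q : ℕ+) (x : N.sub p) (y : N.sub q) : N.Piece (p + q) :=
  N.toPiece (p + q) ⟨⁅(x : G), (y : G)⁆, N.comm_mem x.2 y.2⟩

theorem commClass_mul_left (p q : ℕ+) (x x' : N.sub p) (y : N.sub q) :
    N.commClass p q (x * x') y = N.commClass p q x y + N.commClass p q x' y := by
  have hc : (x : G) * ⁅(x' : G), (y : G)⁆ * (x : G)⁻¹ ∈ N.sub (p + q) :=
    (N.sub_normal _).conj_mem _ (N.comm_mem x'.2 y.2) _
  have h := N.toPiece_conj (p + q) x ⟨⁅(x' : G), (y : G)⁆, N.comm_mem x'.2 y.2⟩ hc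
  rw [add_comm (N.commClass p q x y), commClass, commClass, commClass, ← h, ← toPiece_mul]
  congr 1
  ext
  exact commutatorElement_mul_left_eq_conj_mul _ _ _

theorem commClass_mul_right (p q : ℕ+) (x : N.sub p) (y y' : N.sub q) :
    N.commClass p q x (y * y') = N.commClass p q x y + N.commClass p q x y' := by
  have hc : (y : G) * ⁅(x : G), (y' : G)⁆ * (y : G)⁻¹ ∈ N.sub (p + q) :=
    (N.sub_normal _).conj_mem _ (N.comm_mem x.2 y'.2) _
  have h := N.toPiece_conj (p + q) y ⟨⁅(x : G), (y' : G)⁆, N.comm_mem x.2 y'.2⟩ hc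
  rw [commClass, commClass, commClass, ← h, ← toPiece_mul]
  congr 1
  ext
  simpa [mul_assoc] using commutatorElement_mul_right_eq_mul_conj (x : G) (y : G) (y' : G)

theorem commClass_eq_zero_left (p q : ℕ+) (x : N.sub p) (y : N.sub q)
    (hx : (x : G) ∈ N.sub (p + 1)) : N.commClass p q x y = 0 := by
  rw [commClass, toPiece_eq_zero_iff, add_right_comm]
  exact N.comm_mem hx y.2

theorem commClass_eq_zero_right (p q : ℕ+) (x : N.sub p) (y : N.sub q)
    (hy : (y : G) ∈ N.sub (q + 1)) : N.commClass p q x y = 0 := by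
  rw [commClass, toPiece_eq_zero_iff, add_assoc]
  exact N.comm_mem x.2 hy

/-- An additive homomorphism out of `G_p / G_{p+1}` from a homomorphism out of `G_p`. -/
def pieceLift {A : Type*} [AddCommGroup A] (p : ℕ+) (f : N.sub p → A)
    (hmul : ∀ x y, f (x * y) = f x + f y) (hzero : ∀ x : N.sub p, x.1 ∈ N.sub (p + 1) → f x = 0) :
    N.Piece p →+ A :=
  MonoidHom.toAdditiveLeft (QuotientGroup.lift ((N.sub (p + 1)).subgroupOf (N.sub p))
    (MonoidHom.mk' (fun x => Multiplicative.ofAdd (f x))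
      (fun x y => congrArg Multiplicative.ofAdd (hmul x y)))
    (fun x hx => congrArg Multiplicative.ofAdd (hzero x hx)))

theorem pieceLift_toPiece {A : Type*} [AddCommGroup A] (p : ℕ+) (f : N.sub p → A)
    (hmul : ∀ x y, f (x * y) = f x + f y) (hzero : ∀ x : N.sub p, x.1 ∈ N.sub (p + 1) → f x = 0)
    (x : N.sub p) : N.pieceLift p f hmul hzero (N.toPiece p x) = f x := rfl

/-- The bracket `G_p / G_{p+1} × G_q / G_{q+1} → G_{p+q} / G_{p+q+1}` induced by the commutator. -/
def pieceBracket (p q : ℕ+) : N.Piece p →+ N.Piece q →+ N.Piece (p + q) :=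
  N.pieceLift p
    (fun x => N.pieceLift q (N.commClass p q x) (N.commClass_mul_right p q x)
      (N.commClass_eq_zero_right p q x))
    (fun x x' => by
      ext y
      obtain ⟨y, rfl⟩ := N.toPiece_surjective q y
      exact N.commClass_mul_left p q x x' y)
    (fun x hx => by
      ext y
      obtain ⟨y, rfl⟩ := N.toPiece_surjective q y
      exact N.commClass_eq_zero_left p q x y hx)

/-- The associated graded group `⨁_{p ≥ 1} G_p / G_{p+1}`. -/
def Gr : Type _ := DirectSum ℕ+ N.Piece

noncomputable instance : AddCommGroup N.Gr := inferInstanceAs (AddCommGroup (DirectSum ℕ+ N.Piece))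

/-- The class `g G_{p+1}` of an element `g` of `G_p`, as a homogeneous element of degree `p`
of the associated graded group. -/
noncomputable def cls (p : ℕ+) (g : N.sub p) : N.Gr := DirectSum.of N.Piece p (N.toPiece p g)

/-- The bracket on `⨁_{p ≥ 1} G_p / G_{p+1}`, as a biadditive map. -/
noncomputable def bracketHom : N.Gr →+ N.Gr →+ N.Gr :=
  DirectSum.toAddMonoid fun p => AddMonoidHom.flip (DirectSum.toAddMonoid fun q =>
    AddMonoidHom.flip ((AddMonoidHom.compHom (DirectSum.of N.Piece (p + q))).comp
      (N.pieceBracket p q)))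

noncomputable instance : Bracket N.Gr N.Gr := ⟨fun a b => N.bracketHom a b⟩

theorem cls_lie (p q : ℕ+) (x : N.sub p) (y : N.sub q) :
    ⁅N.cls p x, N.cls q y⁆ = N.cls (p + q) ⟨⁅(x : G), (y : G)⁆, N.comm_mem x.2 y.2⟩ := by
  change N.bracketHom (N.cls p x) (N.cls q y) = _
  unfold bracketHom cls
  erw [DirectSum.toAddMonoid_of, AddMonoidHom.flip_apply, DirectSum.toAddMonoid_of]
  rfl

theorem cls_mul (p : ℕ+) (x y : N.sub p) : N.cls p (x * y) = N.cls p x + N.cls p y := by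
  unfold cls
  rw [toPiece_mul]
  exact map_add (DirectSum.of N.Piece p) _ _

theorem cls_one (p : ℕ+) : N.cls p 1 = 0 := map_zero (DirectSum.of N.Piece p)

theorem cls_congr {p q : ℕ+} (h : p = q) {x : N.sub p} {y : N.sub q} (hxy : (x : G) = y) :
    N.cls p x = N.cls q y := by
  subst h
  rw [Subtype.ext hxy]

theorem cls_conj (p : ℕ+) (x : G) (g : N.sub p) (h : x * g * x⁻¹ ∈ N.sub p) :
    N.cls p ⟨x * g * x⁻¹, h⟩ = N.cls p g := by
  unfold cls
  rw [toPiece_conj]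

theorem gr_induction {P : N.Gr → Prop} (h0 : P 0) (hc : ∀ p g, P (N.cls p g))
    (ha : ∀ a b, P a → P b → P (a + b)) (a : N.Gr) : P a := by
  refine DirectSum.induction_on (motive := P) a h0 (fun p x => ?_) ha
  obtain ⟨g, rfl⟩ := N.toPiece_surjective p x
  exact hc p g

theorem gr_add_lie (a b c : N.Gr) : ⁅a + b, c⁆ = ⁅a, c⁆ + ⁅b, c⁆ := by
  change N.bracketHom _ _ = N.bracketHom _ _ + N.bracketHom _ _
  rw [map_add, AddMonoidHom.add_apply]

theorem gr_lie_add (a b c : N.Gr) : ⁅a, b + c⁆ = ⁅a, b⁆ + ⁅a, c⁆ :=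
  map_add (N.bracketHom a) _ _

theorem gr_zero_lie (a : N.Gr) : ⁅(0 : N.Gr), a⁆ = 0 := by
  change N.bracketHom _ _ = _
  rw [map_zero, AddMonoidHom.zero_apply]

theorem gr_lie_zero (a : N.Gr) : ⁅a, (0 : N.Gr)⁆ = 0 := map_zero (N.bracketHom a)

theorem gr_lie_skew (a b : N.Gr) : ⁅a, b⁆ + ⁅b, a⁆ = 0 := by
  induction a using N.gr_induction with
  | h0 => rw [gr_zero_lie, gr_lie_zero, add_zero]
  | ha a a' h h' =>
    rw [gr_add_lie, gr_lie_add, add_add_add_comm, h, h', add_zero]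
  | hc p x =>
    induction b using N.gr_induction with
    | h0 => rw [gr_zero_lie, gr_lie_zero, add_zero]
    | ha a a' h h' =>
      rw [gr_add_lie, gr_lie_add, add_add_add_comm, h, h', add_zero]
    | hc q y =>
      have hm : ⁅(y : G), (x : G)⁆ ∈ N.sub (p + q) := add_comm q p ▸ N.comm_mem y.2 x.2
      rw [cls_lie, cls_lie, N.cls_congr (add_comm q p) (y := ⟨⁅(y : G), (x : G)⁆, hm⟩) rfl,
        ← cls_mul, ← N.cls_one (p + q)]
      congr 1
      ext
      simp [commutatorElement_def, mul_assoc]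

theorem gr_lie_self (a : N.Gr) : ⁅a, a⁆ = 0 := by
  induction a using N.gr_induction with
  | h0 => exact N.gr_zero_lie 0
  | ha a b h h' =>
    rw [gr_add_lie, gr_lie_add, gr_lie_add, h, h', zero_add, add_zero, gr_lie_skew]
  | hc p x =>
    rw [cls_lie, ← N.cls_one (p + p)]
    congr 1
    ext
    simp

theorem gr_jacobi (a b c : N.Gr) : ⁅⁅a, b⁆, c⁆ + ⁅⁅b, c⁆, a⁆ + ⁅⁅c, a⁆, b⁆ = 0 := by
  induction a using N.gr_induction with
  | h0 => simp only [gr_zero_lie, gr_lie_zero, add_zero]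
  | ha a a' h h' =>
    simp only [gr_add_lie, gr_lie_add]
    rw [← add_zero (0 : N.Gr)]
    nth_rewrite 1 [← h]
    rw [← h']
    abel
  | hc p x =>
  induction b using N.gr_induction with
  | h0 => simp only [gr_zero_lie, gr_lie_zero, add_zero]
  | ha a a' h h' =>
    simp only [gr_add_lie, gr_lie_add]
    rw [← add_zero (0 : N.Gr)]
    nth_rewrite 1 [← h]
    rw [← h']
    abel
  | hc q y =>
  induction c using N.gr_induction with
  | h0 => simp only [gr_zero_lie, gr_lie_zero, add_zero]
  | ha a a' h h' =>
    simp only [gr_add_lie, gr_lie_add]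
    rw [← add_zero (0 : N.Gr)]
    nth_rewrite 1 [← h]
    rw [← h']
    abel
  | hc r z =>
    have hz := (N.sub_normal r).conj_mem _ z.2 (y : G)
    have hx := (N.sub_normal p).conj_mem _ x.2 (z : G)
    have hy := (N.sub_normal q).conj_mem _ y.2 (x : G)
    rw [← N.cls_conj r y z hz, N.cls_lie p q, cls_lie, N.cls_conj r y z hz,
      ← N.cls_conj p z x hx, N.cls_lie q r, cls_lie, N.cls_conj p z x hx,
      ← N.cls_conj q x y hy, N.cls_lie r p, cls_lie]
    have e1 : q + r + p = p + q + r := by rw [add_comm, ← add_assoc]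
    have e2 : r + p + q = p + q + r := by rw [add_assoc, add_comm]
    rw [N.cls_congr e1 (y := ⟨⁅⁅(y : G), (z : G)⁆, (z : G) * x * (z : G)⁻¹⁆,
        e1 ▸ N.comm_mem (N.comm_mem y.2 z.2) hx⟩) rfl,
      N.cls_congr e2 (y := ⟨⁅⁅(z : G), (x : G)⁆, (x : G) * y * (x : G)⁻¹⁆,
        e2 ▸ N.comm_mem (N.comm_mem z.2 x.2) hy⟩) rfl,
      ← cls_mul, ← cls_mul, ← N.cls_one (p + q + r)]
    congr 1
    ext
    exact commutatorElement_commutatorElement_conj_mul (x : G) (y : G) (z : G)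

/-- The Lie ring structure on `⨁_{p ≥ 1} G_p / G_{p+1}`, whose bracket is induced by the
commutator of `G` (see `cls_lie`). The commutators `x y x⁻¹ y⁻¹` and `x⁻¹ y⁻¹ x y` induce the
same bracket. -/
noncomputable instance : LieRing N.Gr where
  add_lie := N.gr_add_lie
  lie_add := N.gr_lie_add
  lie_self := N.gr_lie_self
  leibniz_lie a b c := by
    have h := N.gr_jacobi a b c
    have h1 := N.gr_lie_skew a ⁅b, c⁆
    have h2 := N.gr_lie_skew b ⁅a, c⁆
    have h3 : ⁅⁅c, a⁆, b⁆ + ⁅⁅a, c⁆, b⁆ = 0 := by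
      rw [← gr_add_lie, gr_lie_skew, gr_zero_lie]
    rw [eq_neg_of_add_eq_zero_left h1, eq_neg_of_add_eq_zero_left h2,
      ← eq_neg_of_add_eq_zero_left h3, neg_eq_iff_add_eq_zero, ← h]
    abel

/-- The morphism of Lie rings induced by a homomorphism of groups which respects filtrations. -/
noncomputable def grMap {H : Type*} [Group H] {N : CentralFiltration G} {M : CentralFiltration H}
    (f : G →* H) (hf : ∀ p, ∀ g ∈ N.sub p, f g ∈ M.sub p) : N.Gr →ₗ⁅ℤ⁆ M.Gr :=
  let F : N.Gr →+ M.Gr := DirectSum.toAddMonoid fun p =>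
    N.pieceLift p (fun x => M.cls p ⟨f x, hf p x x.2⟩)
      (fun x y => by
        rw [← cls_mul]
        congr 1
        ext
        simp)
      (fun x hx => by
        have h : M.toPiece p ⟨f x, hf p x x.2⟩ = 0 := M.toPiece_eq_zero_iff.2 (hf _ _ hx)
        rw [cls, h]
        exact map_zero (DirectSum.of M.Piece p))
  have hF : ∀ p x, F (N.cls p x) = M.cls p ⟨f x, hf p x x.2⟩ := fun p x => by
    change DirectSum.toAddMonoid _ (DirectSum.of N.Piece p _) = _
    rw [DirectSum.toAddMonoid_of, pieceLift_toPiece]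
  { F.toIntLinearMap with
    map_lie' := by
      intro a b
      change F ⁅a, b⁆ = ⁅F a, F b⁆
      induction a using N.gr_induction with
      | h0 => rw [gr_zero_lie, map_zero, gr_zero_lie]
      | ha a a' h h' => rw [gr_add_lie, map_add, map_add, gr_add_lie, h, h']
      | hc p x =>
        induction b using N.gr_induction with
        | h0 => rw [gr_lie_zero, map_zero, gr_lie_zero]
        | ha a a' h h' => rw [gr_lie_add, map_add, map_add, gr_lie_add, h, h']
        | hc q y =>
          rw [cls_lie, hF, hF, hF, cls_lie]
          congr 1
          ext
          simp }

theorem grMap_cls {H : Type*} [Group H] {N : CentralFiltration G} {M : CentralFiltration H}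
    (f : G →* H) (hf : ∀ p, ∀ g ∈ N.sub p, f g ∈ M.sub p) (p : ℕ+) (x : N.sub p) :
    grMap f hf (N.cls p x) = M.cls p ⟨f x, hf p x x.2⟩ := by
  change DirectSum.toAddMonoid _ (DirectSum.of N.Piece p _) = _
  rw [DirectSum.toAddMonoid_of, pieceLift_toPiece]

end CentralFiltration

/-! ### The descending central series -/

/-- The `p`-th stage `Γ^p(G)` of the descending central series: `Γ^1(G) = G` and
`Γ^{p+1}(G) = [Γ^p(G), G]`. -/
def Gam (G : Type*) [Group G] (p : ℕ+) : Subgroup G :=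
  (⊤ : Subgroup G).lowerCentralSeries p.natPred

theorem Gam_one (G : Type*) [Group G] : Gam G 1 = ⊤ := rfl

theorem Gam_succ (G : Type*) [Group G] (p : ℕ+) : Gam G (p + 1) = ⁅Gam G p, ⊤⁆ := by
  have h : (p + 1).natPred = p.natPred + 1 := by
    have := PNat.natPred_add_one p
    have := PNat.natPred_add_one (p + 1)
    rw [PNat.add_coe, PNat.one_coe] at this
    omega
  rw [Gam, h]
  rfl

instance (G : Type*) [Group G] (p : ℕ+) : (Gam G p).Characteristic :=
  Subgroup.lowerCentralSeries_characteristic _ _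

theorem commutator_Gam_le (G : Type*) [Group G] (p q : ℕ+) :
    ⁅Gam G p, Gam G q⁆ ≤ Gam G (p + q) := by
  induction q using PNat.recOn generalizing p with
  | one => rw [Gam_one, Gam_succ]
  | succ q ih =>
    set K := Gam G (p + (q + 1)) with hK
    have e : ∀ A B C : Subgroup G, ⁅⁅B, C⁆, A⁆ ≤ K → ⁅⁅C, A⁆, B⁆ ≤ K → ⁅⁅A, B⁆, C⁆ ≤ K := by
      intro A B C h1 h2
      have key : ∀ X : Subgroup G, X ≤ K ↔ X.map (QuotientGroup.mk' K) = ⊥ := fun X => by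
        rw [Subgroup.map_eq_bot_iff, QuotientGroup.ker_mk']
      rw [key, Subgroup.map_commutator, Subgroup.map_commutator] at h1 h2 ⊢
      exact Subgroup.commutator_commutator_eq_bot_of_rotate h1 h2
    rw [Gam_succ, Subgroup.commutator_comm]
    refine e _ _ _ ?_ ?_
    · rw [Subgroup.commutator_comm ⊤, ← Gam_succ]
      refine (ih (p + 1)).trans (le_of_eq ?_)
      rw [hK, add_assoc, add_comm 1 q]
    · refine (Subgroup.commutator_mono (ih p) le_rfl).trans (le_of_eq ?_)
      rw [hK, ← Gam_succ, add_assoc]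

/-- The descending central series as a strongly central filtration. -/
def dcs (G : Type*) [Group G] : CentralFiltration G where
  sub := Gam G
  sub_one := rfl
  sub_succ_le p := by
    rw [Gam_succ]
    exact Subgroup.commutator_le_left _ _
  commutator_le := commutator_Gam_le G

/-- The Lie ring `gr^DCS(G) = ⨁_{p ≥ 1} Γ^p(G) / Γ^{p+1}(G)`. -/
abbrev GrDCS (G : Type*) [Group G] : Type _ := (dcs G).Gr

theorem map_mem_of_mem_Gam {G H : Type*} [Group G] [Group H] (M : CentralFiltration H)
    (f : G →* H) (p : ℕ+) : ∀ g ∈ (dcs G).sub p, f g ∈ M.sub p := by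
  change Gam G p ≤ (M.sub p).comap f
  induction p using PNat.recOn with
  | one => simp [M.sub_one]
  | succ p ih =>
    rw [Gam_succ, Subgroup.commutator_le]
    intro g hg h _
    rw [Subgroup.mem_comap, map_commutatorElement]
    exact M.comm_mem (ih hg) (by simp [M.sub_one])

/-- The morphism `gr^DCS(G) → gr(M)` induced by a homomorphism `G → H`, where `M` is a strongly
central filtration of `H`. -/
noncomputable def grDCSMap {G H : Type*} [Group G] [Group H] (M : CentralFiltration H)
    (f : G →* H) : GrDCS G →ₗ⁅ℤ⁆ M.Gr :=
  CentralFiltration.grMap f (map_mem_of_mem_Gam M f)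

/-! ### The Johnson filtration -/

/-- The subgroup of the automorphisms of `G` inducing the identity on `G / Γ^{s+1}(G)`. -/
def johnson (G : Type*) [Group G] (s : ℕ+) : Subgroup (MulAut G) where
  carrier := {φ | ∀ x : G, (QuotientGroup.mk (φ x) : G ⧸ Gam G (s + 1)) = QuotientGroup.mk x}
  mul_mem' {φ ψ} hφ hψ x := by
    rw [MulAut.mul_apply]
    exact (hφ _).trans (hψ x)
  one_mem' x := rfl
  inv_mem' {φ} hφ x := by
    have := hφ (φ⁻¹ x)
    rw [MulAut.apply_inv_self] at this
    exact this.symm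

theorem johnson_div_mem {G : Type*} [Group G] {s : ℕ+} {φ : MulAut G} (hφ : φ ∈ johnson G s)
    (x : G) : φ x * x⁻¹ ∈ Gam G (s + 1) := by
  have h := QuotientGroup.eq.1 (hφ x).symm
  have h2 := Subgroup.Normal.conj_mem (inferInstance : (Gam G (s + 1)).Normal) _ h x
  simpa using h2

theorem mem_johnson_iff {G : Type*} [Group G] {s : ℕ+} {φ : MulAut G} :
    φ ∈ johnson G s ↔ ∀ x, φ x * x⁻¹ ∈ Gam G (s + 1) := by
  refine ⟨johnson_div_mem, fun h x => ?_⟩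
  refine (QuotientGroup.eq.2 ?_).symm
  have h2 := Subgroup.Normal.conj_mem (inferInstance : (Gam G (s + 1)).Normal) _ (h x) x⁻¹
  simpa [mul_assoc] using h2

theorem johnson_div_mem_of_mem {G : Type*} [Group G] {s : ℕ+} {φ : MulAut G}
    (hφ : φ ∈ johnson G s) (p : ℕ+) {y : G} (hy : y ∈ Gam G p) :
    φ y * y⁻¹ ∈ Gam G (p + s) := by
  induction p using PNat.recOn generalizing y with
  | one => rw [add_comm]; exact johnson_div_mem hφ y
  | succ p ih =>
    let π := QuotientGroup.mk' (Gam G (p + 1 + s))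
    suffices h : Gam G (p + 1) ≤ (π.comp φ.toMonoidHom).eqLocus π by
      have h1 : π (φ y) = π y := h hy
      rw [← QuotientGroup.eq_one_iff]
      change π (φ y * y⁻¹) = 1
      rw [map_mul, map_inv, h1, mul_inv_cancel]
    rw [Gam_succ, Subgroup.commutator_le]
    intro a ha b _
    have hu := ih ha
    have hv := johnson_div_mem hφ b
    obtain ⟨u, hu'⟩ : ∃ u, u = φ a * a⁻¹ := ⟨_, rfl⟩
    obtain ⟨v, hv'⟩ : ∃ v, v = φ b * b⁻¹ := ⟨_, rfl⟩
    rw [← hu'] at hu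
    rw [← hv'] at hv
    have ea : φ a = u * a := by rw [hu']; group
    have eb : φ b = v * b := by rw [hv']; group
    have comm_of : ∀ {q r : ℕ+} {c d : G}, c ∈ Gam G q → d ∈ Gam G r → q + r = p + 1 + s →
        Commute (π c) (π d) := by
      intro q r c d hc hd h
      rw [← commutatorElement_eq_one_iff_commute, ← map_commutatorElement]
      refine (QuotientGroup.eq_one_iff _).2 ?_
      rw [← h]
      exact (dcs G).comm_mem hc hd
    have c1 : ∀ d, Commute (π u) (π d) := fun d =>
      comm_of hu (show d ∈ Gam G 1 from Subgroup.mem_top d) (by rw [add_right_comm])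
    have c2 : Commute (π v) (π a) := comm_of hv ha (by rw [add_comm, ← add_assoc, add_right_comm])
    have c3 : Commute (π v) (π ⁅a, b⁆) := by
      have hab : ⁅a, b⁆ ∈ Gam G (p + 1) := (dcs G).comm_mem ha (show b ∈ (dcs G).sub 1 from Subgroup.mem_top b)
      rw [← commutatorElement_eq_one_iff_commute, ← map_commutatorElement]
      refine (QuotientGroup.eq_one_iff _).2 ?_
      have h := (dcs G).comm_mem (show v ∈ (dcs G).sub (s + 1) from hv)
        (show ⁅a, b⁆ ∈ (dcs G).sub (p + 1) from hab)
      refine (dcs G).le_of_le ?_ h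
      rw [add_comm (p + 1) s]
      exact add_le_add_left (PNat.lt_add_right s 1).le (p + 1)
    change π (φ ⁅a, b⁆) = π ⁅a, b⁆
    rw [map_commutatorElement φ, ea, eb, commutatorElement_mul_left_eq_conj_mul]
    have d1 : π (u * ⁅a, v * b⁆ * u⁻¹) = π ⁅a, v * b⁆ := by
      rw [map_mul, map_mul, map_inv, (c1 _).eq, mul_inv_cancel_right]
    have d2 : π ⁅u, v * b⁆ = 1 := by
      rw [map_commutatorElement, commutatorElement_eq_one_iff_commute]
      exact c1 _
    have d3 : π ⁅a, v⁆ = 1 := by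
      rw [map_commutatorElement, commutatorElement_eq_one_iff_commute]
      exact c2.symm
    rw [map_mul, d1, d2, mul_one, commutatorElement_mul_right_eq_mul_conj]
    rw [map_mul, map_mul, map_mul, map_inv, d3, one_mul, c3.eq, mul_inv_cancel_right]

theorem commutator_johnson_le (G : Type*) [Group G] (s t : ℕ+) :
    ⁅johnson G s, johnson G t⁆ ≤ johnson G (s + t) := by
  rw [Subgroup.commutator_le]
  intro φ hφ ψ hψ x
  obtain ⟨z, rfl⟩ : ∃ z, x = ψ (φ z) := ⟨φ⁻¹ (ψ⁻¹ x), by simp⟩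
  have e : ⁅φ, ψ⁆ (ψ (φ z)) = φ (ψ z) := by simp [commutatorElement_def]
  rw [e]
  have hu := johnson_div_mem hφ z
  have hv := johnson_div_mem hψ z
  obtain ⟨u, hu'⟩ : ∃ u, u = φ z * z⁻¹ := ⟨_, rfl⟩
  obtain ⟨v, hv'⟩ : ∃ v, v = ψ z * z⁻¹ := ⟨_, rfl⟩
  rw [← hu'] at hu
  rw [← hv'] at hv
  have eu : φ z = u * z := by rw [hu']; group
  have ev : ψ z = v * z := by rw [hv']; group
  have h1 := johnson_div_mem_of_mem hφ _ hv
  have h2 := johnson_div_mem_of_mem hψ _ hu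
  have h3 := (dcs G).comm_mem (show u ∈ (dcs G).sub (s + 1) from hu)
    (show v ∈ (dcs G).sub (t + 1) from hv)
  let π := QuotientGroup.mk' (Gam G (s + t + 1))
  have h1' : π (φ v) = π v := by
    rw [← mul_inv_eq_one, ← map_inv, ← map_mul]
    refine (QuotientGroup.eq_one_iff _).2 ?_
    rwa [show s + t + 1 = t + 1 + s by rw [add_comm s t, add_right_comm]]
  have h2' : π (ψ u) = π u := by
    rw [← mul_inv_eq_one, ← map_inv, ← map_mul]
    refine (QuotientGroup.eq_one_iff _).2 ?_
    rwa [show s + t + 1 = s + 1 + t by rw [add_right_comm]]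
  have h3' : Commute (π u) (π v) := by
    rw [← commutatorElement_eq_one_iff_commute, ← map_commutatorElement]
    refine (QuotientGroup.eq_one_iff _).2 ((dcs G).le_of_le ?_ h3)
    rw [add_add_add_comm]
    exact add_le_add_right (PNat.lt_add_right 1 1).le (s + t)
  change π _ = π _
  rw [eu, ev, map_mul φ, map_mul ψ, eu, ev, map_mul π, map_mul π, map_mul π, map_mul π, h1', h2',
    ← mul_assoc, ← mul_assoc, h3'.eq]

/-! ### The groups -/

/-- The free group `F_n` on `x_1, …, x_n`; the generator `x_{i+1}` is `FreeGroup.of i`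
for `i : Fin n`. -/
abbrev Fr (n : ℕ) : Type := FreeGroup (Fin n)

/-- The automorphism group `Aut(F_n)`; the product is `(φ * ψ) x = φ (ψ x)`. -/
abbrev AutFr (n : ℕ) : Type := MulAut (Fr n)

/-- The group `IA_n` of the automorphisms of `F_n` inducing the identity on the abelianization
`H_1(F_n)`. -/
def IA (n : ℕ) : Subgroup (AutFr n) where
  carrier := {φ | ∀ x : Fr n, Abelianization.of (φ x) = Abelianization.of x}
  mul_mem' {φ ψ} hφ hψ x := by
    rw [MulAut.mul_apply]
    exact (hφ _).trans (hψ x)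
  one_mem' x := rfl
  inv_mem' {φ} hφ x := by
    have := hφ (φ⁻¹ x)
    rw [MulAut.apply_inv_self] at this
    exact this.symm

theorem johnson_one (n : ℕ) : johnson (Fr n) 1 = IA n := rfl

/-- The Johnson filtration `J_n^1 ≥ J_n^2 ≥ ⋯` of `IA_n = J_n^1`, where `J_n^s` is the group of
the automorphisms of `F_n` inducing the identity on `F_n / Γ^{s+1}(F_n)`. -/
def johnsonFiltration (n : ℕ) : CentralFiltration (IA n) where
  sub s := (johnson (Fr n) s).subgroupOf (IA n)
  sub_one := by rw [johnson_one, Subgroup.subgroupOf_self]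
  sub_succ_le s := by
    refine Subgroup.comap_mono fun φ hφ => ?_
    rw [mem_johnson_iff] at hφ ⊢
    exact fun x => (dcs (Fr n)).sub_succ_le _ (hφ x)
  commutator_le s t := by
    rw [Subgroup.commutator_le]
    intro φ hφ ψ hψ
    exact commutator_johnson_le _ s t (Subgroup.commutator_mem_commutator hφ hψ)

/-- The Johnson Lie ring `gr^J(IA_n) = ⨁_{s ≥ 1} J_n^s / J_n^{s+1}`. -/
abbrev GrJ (n : ℕ) : Type := (johnsonFiltration n).Gr

/-- For `φ` in `J_n^s`, the element `φ(x) x⁻¹` of `Γ^{s+1}(F_n)`. -/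
def johnsonDisplacement {n : ℕ} {s : ℕ+} (φ : (johnsonFiltration n).sub s) (x : Fr n) :
    (dcs (Fr n)).sub (s + 1) :=
  ⟨(φ : IA n).1 x * x⁻¹, johnson_div_mem φ.2 x⟩

/-- The endomorphism of `F_n` with `x_i ↦ w x_i w⁻¹` and `x_r ↦ x_r` for `r ≠ i`. -/
def conjHom {n : ℕ} (i : Fin n) (w : Fr n) : Fr n →* Fr n :=
  FreeGroup.lift fun r => if r = i then w * FreeGroup.of r * w⁻¹ else FreeGroup.of r

theorem conjHom_of {n : ℕ} (i r : Fin n) (w : Fr n) : conjHom i w (FreeGroup.of r) =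
    if r = i then w * FreeGroup.of r * w⁻¹ else FreeGroup.of r := by
  simp [conjHom]

/-- The automorphism `α_{i,j}` of `F_n`: `x_i ↦ x_j x_i x_j⁻¹` and `x_r ↦ x_r` for `r ≠ i`. -/
def alpha {n : ℕ} (i j : Fin n) : AutFr n :=
  MonoidHom.toMulEquiv (conjHom i (FreeGroup.of j)) (conjHom i (FreeGroup.of j)⁻¹)
    (by
      ext r
      by_cases hr : r = i <;> by_cases hj : j = i <;> simp [conjHom_of, hr, hj, mul_assoc])
    (by
      ext r
      by_cases hr : r = i <;> by_cases hj : j = i <;> simp [conjHom_of, hr, hj, mul_assoc])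

theorem alpha_of {n : ℕ} (i j r : Fin n) : alpha i j (FreeGroup.of r) =
    if r = i then FreeGroup.of j * FreeGroup.of r * (FreeGroup.of j)⁻¹ else FreeGroup.of r :=
  conjHom_of i r _

theorem mulAut_ext_of {n : ℕ} {φ ψ : AutFr n}
    (h : ∀ r, φ (FreeGroup.of r) = ψ (FreeGroup.of r)) : φ = ψ := by
  have h2 : φ.toMonoidHom = ψ.toMonoidHom := FreeGroup.ext_hom _ _ h
  ext x
  exact DFunLike.congr_fun h2 x

/-- The upper triangular McCool group `PΣ_n^+`, generated by the `α_{i,j}` with `j < i`. -/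
def PSigmaPlus (n : ℕ) : Subgroup (AutFr n) :=
  Subgroup.closure {φ | ∃ i j : Fin n, j < i ∧ φ = alpha i j}

theorem PSigmaPlus_le_IA (n : ℕ) : PSigmaPlus n ≤ IA n := by
  rw [PSigmaPlus, Subgroup.closure_le]
  rintro _ ⟨i, j, _, rfl⟩ x
  have h : (Abelianization.of).comp (alpha i j).toMonoidHom = (Abelianization.of : Fr n →* _) := by
    ext r
    change Abelianization.of (alpha i j (FreeGroup.of r)) = Abelianization.of (FreeGroup.of r)
    rw [alpha_of]
    split_ifs
    · rw [map_mul, map_mul, map_inv, mul_inv_cancel_comm]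
    · rfl
  exact DFunLike.congr_fun h x

/-- The subgroup `G(n,m,j)` of `PΣ_n^+` generated by `α_{m,1}, …, α_{m,j}` (where `j < m`). The
indices `1, …, n` are represented by the elements of `Fin n`, shifted by one. -/
def GSub (n : ℕ) (m : Fin n) (j : ℕ) : Subgroup (PSigmaPlus n) :=
  Subgroup.closure {φ | ∃ t : Fin n, (t : ℕ) + 1 ≤ j ∧ (φ : AutFr n) = alpha m t}

/-- The direct product `H(n,k) = G(n,k,k-1) × G(n,k+1,k-1) × ⋯ × G(n,n,k-1)`. -/
abbrev HProd (n k : ℕ) : Type :=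
  (m : {m : Fin n // k ≤ (m : ℕ) + 1}) → GSub n m.1 (k - 1)

theorem alpha_commute {n : ℕ} {i i' j j' : Fin n} (h : i ≠ i') (h1 : j ≠ i') (h2 : j' ≠ i) :
    Commute (alpha i j) (alpha i' j') := by
  refine mulAut_ext_of fun r => ?_
  rw [MulAut.mul_apply, MulAut.mul_apply, alpha_of, alpha_of]
  by_cases hr : r = i
  · subst hr
    simp [alpha_of, h, h1]
  · by_cases hr' : r = i'
    · subst hr'
      simp [alpha_of, h.symm, h2]
    · simp [alpha_of, hr, hr']

theorem GSub_commute (n k : ℕ) :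
    Pairwise fun m m' : {m : Fin n // k ≤ (m : ℕ) + 1} =>
      ∀ x y : PSigmaPlus n, x ∈ GSub n m.1 (k - 1) → y ∈ GSub n m'.1 (k - 1) → Commute x y := by
  intro m m' hm x y hx hy
  have h : GSub n m.1 (k - 1) ≤ Subgroup.centralizer (GSub n m'.1 (k - 1)) := by
    rw [GSub, GSub, Subgroup.centralizer_closure, Subgroup.closure_le]
    rintro a ⟨t, ht, ha⟩
    rw [SetLike.mem_coe, Subgroup.mem_centralizer_iff]
    rintro b ⟨t', ht', hb⟩
    refine Subtype.ext ?_
    rw [Subgroup.coe_mul, Subgroup.coe_mul, ha, hb]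
    have h1 := m.2
    have h2 := m'.2
    refine (alpha_commute (fun e => hm (Subtype.ext e)) ?_ ?_).eq.symm
    · rintro rfl
      omega
    · rintro rfl
      omega
  exact ((Subgroup.mem_centralizer_iff.1 (h hx)) y hy).symm

/-- The homomorphism `Θ(n,k) : H(n,k) → PΣ_n^+` which restricts to the inclusion on each factor. -/
noncomputable def Theta (n k : ℕ) : HProd n k →* PSigmaPlus n :=
  Subgroup.noncommPiCoprod (GSub_commute n k)

/-- The inclusion `PΣ_n^+ → IA_n`. -/
def inclIA (n : ℕ) : PSigmaPlus n →* IA n := Subgroup.inclusion (PSigmaPlus_le_IA n)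

/-! ### The free Lie algebra and its graded derivations -/

/-- The free Lie algebra `L[V_n]` over `ℤ` on the basis `x_1, …, x_n` of `V_n`. -/
abbrev LV (n : ℕ) : Type := FreeLieAlgebra ℤ (Fin n)

/-- The degree `s` summand `L_s[V_n]`: `L_1[V_n] = V_n` is spanned by the generators, and
`L_{s+1}[V_n]` is spanned by the brackets `[x_i, y]` with `y` in `L_s[V_n]`. There is no summand
of degree `0`. -/
noncomputable def LPiece (n : ℕ) : ℕ → Submodule ℤ (LV n)
  | 0 => ⊥
  | 1 => Submodule.span ℤ (Set.range (FreeLieAlgebra.of ℤ))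
  | s + 2 => Submodule.span ℤ {z | ∃ i : Fin n, ∃ y ∈ LPiece n (s + 1),
      z = ⁅FreeLieAlgebra.of ℤ i, y⁆}

/-- A derivation of `L[V_n]` is homogeneous of degree `s` if it maps `L_p[V_n]` into
`L_{p+s}[V_n]` for all `p`. -/
def IsHomogeneousDer {n : ℕ} (s : ℕ) (D : LieDerivation ℤ (LV n) (LV n)) : Prop :=
  ∀ p, ∀ x ∈ LPiece n p, D x ∈ LPiece n (p + s)

/-- The Lie algebra `Der(L[V_n]) = ⨁_{s ≥ 1} Der_s(L[V_n])` of graded derivations of positive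
degree: the finite sums of homogeneous derivations of degrees `s ≥ 1`, with the bracket
`D D' - D' D`. -/
noncomputable def DerLV (n : ℕ) : LieSubalgebra ℤ (LieDerivation ℤ (LV n) (LV n)) where
  __ := Submodule.span ℤ {D | ∃ s : ℕ, 1 ≤ s ∧ IsHomogeneousDer s D}
  lie_mem' := by
    intro D D' hD hD'
    change D ∈ Submodule.span ℤ _ at hD
    change D' ∈ Submodule.span ℤ _ at hD'
    change _ ∈ Submodule.span ℤ _
    induction hD using Submodule.span_induction with
    | zero => rw [zero_lie]; exact Submodule.zero_mem _
    | add a b _ _ ha hb => rw [add_lie]; exact Submodule.add_mem _ ha hb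
    | smul c a _ ha => rw [smul_lie]; exact Submodule.smul_mem _ c ha
    | mem a ha =>
      induction hD' using Submodule.span_induction with
      | zero => rw [lie_zero]; exact Submodule.zero_mem _
      | add b c _ _ hb hc => rw [lie_add]; exact Submodule.add_mem _ hb hc
      | smul c b _ hb => rw [lie_smul]; exact Submodule.smul_mem _ c hb
      | mem b hb =>
        obtain ⟨s, hs, ha⟩ := ha
        obtain ⟨t, ht, hb⟩ := hb
        refine Submodule.subset_span ⟨s + t, by omega, fun p x hx => ?_⟩
        rw [LieDerivation.commutator_apply]
        refine Submodule.sub_mem _ ?_ ?_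
        · have h := ha _ _ (hb _ _ hx)
          rwa [add_assoc, add_comm t s] at h
        · have h := hb _ _ (ha _ _ hx)
          rwa [add_assoc] at h

/-- The canonical morphism of Lie algebras `L[V_n] → gr^DCS(F_n)`, which maps the generator `x_i`
to the class of `x_i` in `Γ^1(F_n) / Γ^2(F_n)`. -/
noncomputable def wittMap (n : ℕ) : LV n →ₗ⁅ℤ⁆ GrDCS (Fr n) :=
  FreeLieAlgebra.lift ℤ fun i => (dcs (Fr n)).cls 1 ⟨FreeGroup.of i, Subgroup.mem_top _⟩

/-!
For the first claim, the Magnus expansion `x_i ↦ 1 + X_i t` sends an element of `Γ^p(F_n)` to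
`1 + c t^p + ⋯`, and the leading coefficients `c` give a morphism of Lie rings from `gr^DCS(F_n)` to
the free associative algebra (`magnusLie`), whose composite with `wittMap` is the canonical map from
the free Lie algebra. So everything rests on the fact that the free Lie algebra is, over any
commutative ring, a direct summand of the free associative algebra
(`FreeLieAlgebra.exists_retraction`). This uses Lyndon words: the brackets of Hall trees span the
free Lie algebra (`FreeMagma.IsHall.lie_mem_hallSpan`, by the Jacobi identity), and the bracket of a
Hall tree expands into its word plus lexicographically larger words of the same length, where
different Hall trees have different words. Surjectivity of `wittMap` holds because `gr^DCS` is
generated in degree one.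

The Johnson morphism comes from the Lie ring of a strongly central filtration of `F_n ⋊ IA_n`, with
terms `Γ^p(F_n) ⋊ J_n^p`: there `φ(g) g⁻¹` is the commutator of `φ` and `g`, so `gr^J(IA_n)` acts on
the ideal `gr^DCS(F_n) = L[V_n]` by brackets, and the derivation and morphism properties are
instances of the Jacobi identity.

For the last claim, `w` in the free group on `x_1, …, x_{k-1}` gives the element `x_m ↦ w⁻¹ x_m w`
of `G(n,m,k-1)`, and this is surjective. If `y` in `L[x_1, …, x_{k-1}]` corresponds to the class of
`w`, then `γ` sends the class of this automorphism to the derivation `x_m ↦ [x_m, y]` which kills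
the other generators (`hprodDer_freeToHProd`). To recover `y` from `[x_m, y]` additively, map
`L[V_n]` to `2 × 2` matrices over the free associative algebra by `x_i ↦ x_i E₁₁` for `i < k` and
`x_i ↦ E₂₁` for `i ≥ k`. Then `[x_m, y]` goes to `y E₂₁`, and the retraction of the free
associative algebra onto the free Lie algebra returns `y`. As the factors of `H(n,k)` generate it,
this left inverse on each factor is a left inverse of `γ`.
-/

/-! ### Lexicographic order on words -/

section Words

variable {X : Type*} [LinearOrder X]

theorem List.append_lt_append_of_lt_of_not_prefix {u v : List X} (h : u < v) (hp : ¬ u <+: v)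
    (x y : List X) : u ++ x < v ++ y := by
  induction u generalizing v with
  | nil => exact absurd List.nil_prefix hp
  | cons a u ih =>
    cases v with
    | nil => exact absurd h (List.not_lt_nil _)
    | cons b v =>
      rw [List.cons_append, List.cons_append, List.cons_lt_cons_iff]
      rcases List.cons_lt_cons_iff.1 h with h' | ⟨rfl, h'⟩
      · exact Or.inl h'
      · refine Or.inr ⟨rfl, ih h' fun hq => hp ?_⟩
        simpa using hq

theorem List.append_lt_append_of_lt_of_length_le {u v : List X} (h : u < v)
    (hl : v.length ≤ u.length) (x y : List X) : u ++ x < v ++ y :=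
  List.append_lt_append_of_lt_of_not_prefix h
    (fun hp => h.ne (hp.eq_of_length (le_antisymm hp.length_le hl))) x y

theorem List.self_le_append (u x : List X) : u ≤ u ++ x := by
  induction u with
  | nil => exact not_lt.1 (List.not_lt_nil _)
  | cons a u ih =>
    rw [List.cons_append, ← not_lt, List.cons_lt_cons_iff]
    rintro (h | ⟨-, h⟩)
    · exact h.false
    · exact not_lt.2 ih h

/-- A Lyndon word: a nonempty word that is smaller than each of its proper nonempty suffixes. -/
def IsLyndon (l : List X) : Prop :=
  l ≠ [] ∧ ∀ a b, a ++ b = l → a ≠ [] → b ≠ [] → l < b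

theorem isLyndon_singleton (x : X) : IsLyndon [x] := by
  refine ⟨by simp, fun a b h ha hb => ?_⟩
  rcases List.append_eq_singleton_iff.1 h with h | h
  · exact absurd h.1 ha
  · exact absurd h.2 hb

theorem IsLyndon.append_lt {u v : List X} (hv : IsLyndon v) (h : u < v) (hu : u ≠ []) :
    u ++ v < v := by
  by_cases hp : u <+: v
  · obtain ⟨w, rfl⟩ := hp
    refine List.append_left_lt (hv.2 u w rfl hu ?_)
    rintro rfl
    simp at h
  · simpa using List.append_lt_append_of_lt_of_not_prefix h hp v []

theorem IsLyndon.append {u v : List X} (hu : IsLyndon u) (hv : IsLyndon v) (h : u < v) :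
    IsLyndon (u ++ v) := by
  have huv := hv.append_lt h hu.1
  refine ⟨by simp [hu.1], fun a b hab ha hb => ?_⟩
  rcases List.append_eq_append_iff.1 hab with ⟨s, rfl, rfl⟩ | ⟨s, rfl, rfl⟩
  · by_cases hs : s = []
    · subst hs
      simpa using huv
    · exact List.append_lt_append_of_lt_of_length_le (hu.2 a s rfl ha hs)
        (by simp) v v
  · by_cases hs : s = []
    · subst hs
      simpa using huv
    · exact huv.trans (hv.2 s b rfl hs hb)

end Words

/-! ### Hall trees -/

namespace FreeMagma

variable {X : Type*}

/-- The word read off the leaves of a tree. -/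
def foliage : FreeMagma X → List X
  | .of x => [x]
  | .mul a b => foliage a ++ foliage b

theorem foliage_ne_nil (t : FreeMagma X) : t.foliage ≠ [] := by
  induction t using FreeMagma.rec with
  | of x => simp [foliage]
  | mul a b ha hb => simp [foliage, ha]

/-- The iterated bracket in the free Lie algebra prescribed by a tree. -/
noncomputable def bracketing (R : Type*) [CommRing R] : FreeMagma X → FreeLieAlgebra R X
  | .of x => FreeLieAlgebra.of R x
  | .mul a b => ⁅bracketing R a, bracketing R b⁆

variable [LinearOrder X]

/-- The trees which bracket Lyndon words along their standard factorization: in a product `a * b`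
both factors are such trees, the word of `a` is smaller than that of `b`, and the right factor of
`a`, if there is one, has a word at least that of `b`. -/
inductive IsHall : FreeMagma X → Prop
  | of (x : X) : IsHall (.of x)
  | of_mul (x : X) (b : FreeMagma X) : IsHall b → [x] < b.foliage → IsHall (.mul (.of x) b)
  | mul_mul (a b c : FreeMagma X) : IsHall (.mul a b) → IsHall c →
      a.foliage ++ b.foliage < c.foliage → c.foliage ≤ b.foliage → IsHall (.mul (.mul a b) c)

theorem IsHall.mul_iff {a b : FreeMagma X} : IsHall (.mul a b) ↔
    IsHall a ∧ IsHall b ∧ a.foliage < b.foliage ∧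
      ∀ a₁ a₂, a = .mul a₁ a₂ → b.foliage ≤ a₂.foliage := by
  constructor
  · intro h
    cases h with
    | of_mul x _ hb h => exact ⟨.of x, hb, h, by simp⟩
    | mul_mul a₁ a₂ _ ha hb h h' =>
      refine ⟨ha, hb, h, fun _ _ e => ?_⟩
      cases e
      exact h'
  · rintro ⟨ha, hb, h, h'⟩
    cases a with
    | of x => exact .of_mul x b hb h
    | mul a₁ a₂ => exact .mul_mul a₁ a₂ b ha hb h (h' _ _ rfl)

theorem IsHall.isLyndon {t : FreeMagma X} (ht : IsHall t) : IsLyndon t.foliage := by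
  induction t using FreeMagma.rec with
  | of x => exact isLyndon_singleton x
  | mul a b iha ihb =>
    obtain ⟨ha, hb, h, -⟩ := IsHall.mul_iff.1 ht
    exact (iha ha).append (ihb hb) h

/-- The word of the right factor of a Hall tree is the least proper nonempty suffix of the word of
the tree; hence the word determines the factorization. -/
theorem IsHall.foliage_right_le {a b : FreeMagma X} (h : IsHall (.mul a b)) {p s : List X}
    (hps : p ++ s = a.foliage ++ b.foliage) (hp : p ≠ []) (hs : s ≠ []) : b.foliage ≤ s := by
  induction a using FreeMagma.rec generalizing b p s with
  | of x =>
    obtain ⟨-, hb, -, -⟩ := IsHall.mul_iff.1 h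
    rcases List.append_eq_append_iff.1 hps with ⟨r, hr, rfl⟩ | ⟨r, -, hr⟩
    · rcases List.append_eq_singleton_iff.1 hr.symm with hr | hr
      · exact absurd hr.1 hp
      · simp [hr.2]
    · by_cases hr' : r = []
      · simp [hr, hr']
      · exact (hb.isLyndon.2 r s hr.symm hr' hs).le
  | mul a₁ a₂ ih _ =>
    obtain ⟨ha, hb, -, h'⟩ := IsHall.mul_iff.1 h
    rcases List.append_eq_append_iff.1 hps with ⟨r, hr, rfl⟩ | ⟨r, -, hr⟩
    · by_cases hr' : r = []
      · simp [hr']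
      · exact ((h' _ _ rfl).trans (ih ha hr.symm hp hr')).trans (List.self_le_append _ _)
    · by_cases hr' : r = []
      · simp [hr, hr']
      · exact (hb.isLyndon.2 r s hr.symm hr' hs).le

theorem IsHall.foliage_injective {s t : FreeMagma X} (hs : IsHall s) (ht : IsHall t)
    (h : s.foliage = t.foliage) : s = t := by
  induction s using FreeMagma.rec generalizing t with
  | of x =>
    cases t with
    | of y => rw [show x = y by simpa [foliage] using h]
    | mul a b =>
      rcases List.append_eq_singleton_iff.1 h.symm with h | h
      · exact absurd h.1 a.foliage_ne_nil
      · exact absurd h.2 b.foliage_ne_nil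
  | mul a b iha ihb =>
    cases t with
    | of y =>
      rcases List.append_eq_singleton_iff.1 h with h | h
      · exact absurd h.1 a.foliage_ne_nil
      · exact absurd h.2 b.foliage_ne_nil
    | mul c d =>
      have e : b.foliage = d.foliage :=
        le_antisymm (hs.foliage_right_le h.symm c.foliage_ne_nil d.foliage_ne_nil)
          (ht.foliage_right_le h a.foliage_ne_nil b.foliage_ne_nil)
      change a.foliage ++ b.foliage = c.foliage ++ d.foliage at h
      rw [e, List.append_left_inj] at h
      obtain ⟨ha, hb, -, -⟩ := IsHall.mul_iff.1 hs
      obtain ⟨hc, hd, -, -⟩ := IsHall.mul_iff.1 ht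
      rw [iha ha hc h, ihb hb hd e]

/-- The span of the brackets of the Hall trees with `n` leaves whose word is less than `v`. -/
noncomputable def hallSpan (R : Type*) [CommRing R] (n : ℕ) (v : List X) :
    Submodule R (FreeLieAlgebra R X) :=
  Submodule.span R {z | ∃ t : FreeMagma X, t.IsHall ∧ t.foliage.length = n ∧ t.foliage < v ∧
    t.bracketing R = z}

variable (R : Type*) [CommRing R]

/-- The bracket of two Hall trees is a combination of Hall trees. If `a * b` is not Hall then
`a = a₁ * a₂` with `a₂ < b`, and the Jacobi identity rewrites `[[a₁, a₂], b]` in terms of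
`[[a₁, b], a₂]` and `[a₁, [a₂, b]]`; all brackets met on the way either have fewer leaves in total
or have both words less than that of `b`. -/
theorem IsHall.lie_mem_hallSpan [Finite X] {a b : FreeMagma X} (ha : IsHall a) (hb : IsHall b)
    (h : a.foliage < b.foliage) : ⁅a.bracketing R, b.bracketing R⁆ ∈
      hallSpan R (a.foliage.length + b.foliage.length) b.foliage := by
  obtain ⟨n, hn⟩ : ∃ n, n = a.foliage.length + b.foliage.length := ⟨_, rfl⟩
  rw [← hn]
  induction n using Nat.strong_induction_on generalizing a b with
  | _ n ihn =>
  have : Finite {l : List X // l.length ≤ n} := List.finite_length_le X n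
  obtain ⟨v, hv⟩ : ∃ v : {l : List X // l.length ≤ n}, v.1 = b.foliage := ⟨⟨_, by omega⟩, rfl⟩
  induction v using WellFoundedLT.induction generalizing a b with
  | _ v ihv =>
  -- the inner induction, for a bracket in either order, with both words less than `v`
  have key : ∀ {c d : FreeMagma X}, c.IsHall → d.IsHall → c.foliage < v.1 → d.foliage < v.1 →
      n = c.foliage.length + d.foliage.length →
      ⁅c.bracketing R, d.bracketing R⁆ ∈ hallSpan R n v.1 := by
    intro c d hc hd hcv hdv hl
    have mono : ∀ {w : List X}, w < v.1 → hallSpan R n w ≤ hallSpan R n v.1 := fun hw =>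
      Submodule.span_mono fun z ⟨t, h1, h2, h3, h4⟩ => ⟨t, h1, h2, h3.trans hw, h4⟩
    rcases lt_trichotomy c.foliage d.foliage with hcd | hcd | hcd
    · exact mono hdv (ihv ⟨d.foliage, by omega⟩ hdv hc hd hcd hl rfl)
    · rw [hc.foliage_injective hd hcd, lie_self]
      exact Submodule.zero_mem _
    · rw [← lie_skew]
      exact Submodule.neg_mem _
        (mono hcv (ihv ⟨c.foliage, by omega⟩ hcv hd hc hcd (by omega) rfl))
  rw [← hv]
  by_cases hab : IsHall (.mul a b)
  · refine Submodule.subset_span ⟨.mul a b, hab, ?_, ?_, rfl⟩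
    · simp [foliage, hn]
    · rw [hv]
      exact hb.isLyndon.append_lt h a.foliage_ne_nil
  rw [IsHall.mul_iff] at hab
  simp only [ha, hb, h, true_and, not_forall, not_le] at hab
  obtain ⟨a₁, a₂, rfl, h2⟩ := hab
  obtain ⟨h₁, h₂, h12, -⟩ := IsHall.mul_iff.1 ha
  have hl : (FreeMagma.mul a₁ a₂).foliage.length = a₁.foliage.length + a₂.foliage.length := by
    simp [foliage]
  have p1 := List.length_pos_iff.2 a₁.foliage_ne_nil
  have p2 := List.length_pos_iff.2 a₂.foliage_ne_nil
  have h1v : a₁.foliage < v.1 := hv ▸ h12.trans h2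
  have h2v : a₂.foliage < v.1 := hv ▸ h2
  have e : ⁅(FreeMagma.mul a₁ a₂).bracketing R, b.bracketing R⁆ =
      ⁅⁅a₁.bracketing R, b.bracketing R⁆, a₂.bracketing R⁆ +
        ⁅a₁.bracketing R, ⁅a₂.bracketing R, b.bracketing R⁆⁆ := by
    change ⁅⁅a₁.bracketing R, a₂.bracketing R⁆, b.bracketing R⁆ = _
    rw [lie_lie, leibniz_lie (a₁.bracketing R), ← lie_skew (a₂.bracketing R)]
    abel
  rw [e]
  refine Submodule.add_mem _ ?_ ?_
  · have := ihn _ (by omega) h₁ hb (h12.trans h2) rfl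
    generalize ⁅a₁.bracketing R, b.bracketing R⁆ = z at this ⊢
    induction this using Submodule.span_induction with
    | zero => simp
    | add x y _ _ hx hy => rw [add_lie]; exact Submodule.add_mem _ hx hy
    | smul c x _ hx => rw [smul_lie]; exact Submodule.smul_mem _ c hx
    | mem x hx =>
      obtain ⟨t, ht, htl, htv, rfl⟩ := hx
      exact key ht h₂ (hv ▸ htv) h2v (by omega)
  · have := ihn _ (by omega) h₂ hb h2 rfl
    generalize ⁅a₂.bracketing R, b.bracketing R⁆ = z at this ⊢
    induction this using Submodule.span_induction with
    | zero => simp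
    | add x y _ _ hx hy => rw [lie_add]; exact Submodule.add_mem _ hx hy
    | smul c x _ hx => rw [lie_smul]; exact Submodule.smul_mem _ c hx
    | mem x hx =>
      obtain ⟨t, ht, htl, htv, rfl⟩ := hx
      exact key h₁ ht h1v (hv ▸ htv) (by omega)

end FreeMagma

namespace FreeLieAlgebra

variable (R : Type*) [CommRing R] {X : Type*}

/-- A Lie subalgebra which contains the generators is everything. -/
theorem mem_of_forall_of_mem (K : LieSubalgebra R (FreeLieAlgebra R X))
    (h : ∀ x, FreeLieAlgebra.of R x ∈ K) (z : FreeLieAlgebra R X) : z ∈ K := by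
  let f : FreeLieAlgebra R X →ₗ⁅R⁆ K := FreeLieAlgebra.lift R fun x => ⟨of R x, h x⟩
  have hf : K.incl.comp f = LieHom.id := by
    ext x
    simp [f]
  have := LieHom.congr_fun hf z
  rw [LieHom.comp_apply] at this
  rw [show z = K.incl (f z) from this.symm]
  exact (f z).2

theorem span_bracketing_isHall [LinearOrder X] [Finite X] :
    Submodule.span R {z | ∃ t : FreeMagma X, t.IsHall ∧ t.bracketing R = z} = ⊤ := by
  set S := Submodule.span R {z | ∃ t : FreeMagma X, t.IsHall ∧ t.bracketing R = z} with hS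
  have mem : ∀ {n v}, FreeMagma.hallSpan (X := X) R n v ≤ S := fun {n v} =>
    Submodule.span_mono fun z ⟨t, h1, _, _, h4⟩ => ⟨t, h1, h4⟩
  let K : LieSubalgebra R (FreeLieAlgebra R X) :=
    { S with
      lie_mem' := by
        intro x y hx hy
        change x ∈ S at hx
        change y ∈ S at hy
        change _ ∈ S
        induction hx using Submodule.span_induction with
        | zero => simp
        | add a b _ _ ha hb => rw [add_lie]; exact Submodule.add_mem _ ha hb
        | smul c a _ ha => rw [smul_lie]; exact Submodule.smul_mem _ c ha
        | mem a ha =>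
          induction hy using Submodule.span_induction with
          | zero => simp
          | add b c _ _ hb hc => rw [lie_add]; exact Submodule.add_mem _ hb hc
          | smul c b _ hb => rw [lie_smul]; exact Submodule.smul_mem _ c hb
          | mem b hb =>
            obtain ⟨s, hs, rfl⟩ := ha
            obtain ⟨t, ht, rfl⟩ := hb
            rcases lt_trichotomy s.foliage t.foliage with h | h | h
            · exact mem (hs.lie_mem_hallSpan R ht h)
            · rw [hs.foliage_injective ht h, lie_self]
              exact S.zero_mem
            · rw [← lie_skew]
              exact S.neg_mem (mem (ht.lie_mem_hallSpan R hs h)) }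
  exact eq_top_iff.2 fun z _ => mem_of_forall_of_mem R K
    (fun x => Submodule.subset_span ⟨.of x, .of x, rfl⟩) z

end FreeLieAlgebra

/-! ### The free Lie algebra is a direct summand of the free associative algebra -/

attribute [local instance] LieRing.ofAssociativeRing

section Triangular

variable (R : Type*) [CommRing R] {X : Type*}

/-- The monomial of the free associative algebra given by a word. -/
noncomputable def FreeAlgebra.word (l : List X) : FreeAlgebra R X :=
  FreeAlgebra.basisFreeMonoid R X (FreeMonoid.ofList l)

theorem FreeAlgebra.word_eq (l : List X) : FreeAlgebra.word R l =
    FreeAlgebra.equivMonoidAlgebraFreeMonoid.symm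
      (MonoidAlgebra.single (FreeMonoid.ofList l) 1) := by
  simp [FreeAlgebra.word, FreeAlgebra.basisFreeMonoid]

theorem FreeAlgebra.word_append (l l' : List X) :
    FreeAlgebra.word R (l ++ l') = FreeAlgebra.word R l * FreeAlgebra.word R l' := by
  rw [word_eq, word_eq, word_eq, ← map_mul, MonoidAlgebra.single_mul_single, one_mul]
  rfl

theorem FreeAlgebra.word_singleton (x : X) : FreeAlgebra.word R [x] = FreeAlgebra.ι R x := by
  rw [word_eq, AlgEquiv.symm_apply_eq]
  simp [FreeAlgebra.equivMonoidAlgebraFreeMonoid]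

/-- The canonical morphism from the free Lie algebra to the free associative algebra. -/
noncomputable def FreeLieAlgebra.toFreeAlgebra : FreeLieAlgebra R X →ₗ⁅R⁆ FreeAlgebra R X :=
  FreeLieAlgebra.lift R (FreeAlgebra.ι R)

variable [LinearOrder X]

/-- The span of the words `l'` of the same length as `l` with `l ≤ l'`. -/
noncomputable def wordSpanGE (l : List X) : Submodule R (FreeAlgebra R X) :=
  Submodule.span R (FreeAlgebra.word R '' {l' | l'.length = l.length ∧ l ≤ l'})

/-- The span of the words `l'` of the same length as `l` with `l < l'`. -/
noncomputable def wordSpanGT (l : List X) : Submodule R (FreeAlgebra R X) :=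
  Submodule.span R (FreeAlgebra.word R '' {l' | l'.length = l.length ∧ l < l'})

theorem wordSpanGT_le_wordSpanGE (l : List X) : wordSpanGT R l ≤ wordSpanGE R l :=
  Submodule.span_mono (Set.image_mono fun _ h => ⟨h.1, h.2.le⟩)

theorem word_mem_wordSpanGE (l : List X) : FreeAlgebra.word R l ∈ wordSpanGE R l :=
  Submodule.subset_span ⟨l, ⟨rfl, le_rfl⟩, rfl⟩

variable {R}

theorem mul_mem_wordSpanGT_left {u v : List X} {a b : FreeAlgebra R X}
    (ha : a ∈ wordSpanGT R u) (hb : b ∈ wordSpanGE R v) : a * b ∈ wordSpanGT R (u ++ v) := by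
  have h := Submodule.mul_mem_mul ha hb
  rw [wordSpanGT, wordSpanGE, Submodule.span_mul_span] at h
  refine Submodule.span_mono ?_ h
  rintro _ ⟨_, ⟨p, ⟨hp, hp'⟩, rfl⟩, _, ⟨q, ⟨hq, hq'⟩, rfl⟩, rfl⟩
  exact ⟨p ++ q, ⟨by simp [hp, hq], List.append_lt_append_of_lt_of_length_le hp' hp.le _ _⟩,
    FreeAlgebra.word_append R p q⟩

theorem mul_mem_wordSpanGT_right {u v : List X} {a b : FreeAlgebra R X}
    (ha : a ∈ wordSpanGE R u) (hb : b ∈ wordSpanGT R v) : a * b ∈ wordSpanGT R (u ++ v) := by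
  have h := Submodule.mul_mem_mul ha hb
  rw [wordSpanGT, wordSpanGE, Submodule.span_mul_span] at h
  refine Submodule.span_mono ?_ h
  rintro _ ⟨_, ⟨p, ⟨hp, hp'⟩, rfl⟩, _, ⟨q, ⟨hq, hq'⟩, rfl⟩, rfl⟩
  refine ⟨p ++ q, ⟨by simp [hp, hq], ?_⟩, FreeAlgebra.word_append R p q⟩
  rcases hp'.lt_or_eq with hp' | rfl
  · exact List.append_lt_append_of_lt_of_length_le hp' hp.le _ _
  · exact List.append_left_lt hq'

theorem mul_mem_wordSpanGE {u v : List X} {a b : FreeAlgebra R X}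
    (ha : a ∈ wordSpanGE R u) (hb : b ∈ wordSpanGE R v) : a * b ∈ wordSpanGE R (u ++ v) := by
  have h := Submodule.mul_mem_mul ha hb
  rw [wordSpanGE, wordSpanGE, Submodule.span_mul_span] at h
  refine Submodule.span_mono ?_ h
  rintro _ ⟨_, ⟨p, ⟨hp, hp'⟩, rfl⟩, _, ⟨q, ⟨hq, hq'⟩, rfl⟩, rfl⟩
  refine ⟨p ++ q, ⟨by simp [hp, hq], ?_⟩, FreeAlgebra.word_append R p q⟩
  rcases hp'.lt_or_eq with hp' | rfl
  · exact (List.append_lt_append_of_lt_of_length_le hp' hp.le _ _).le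
  · rcases hq'.lt_or_eq with hq' | rfl
    · exact (List.append_left_lt hq').le
    · exact le_rfl

variable (R)

/-- The bracket of a Hall tree is its word plus a combination of larger words. -/
theorem FreeMagma.IsHall.toFreeAlgebra_bracketing_sub_mem {t : FreeMagma X} (ht : t.IsHall) :
    FreeLieAlgebra.toFreeAlgebra R (t.bracketing R) - FreeAlgebra.word R t.foliage ∈
      wordSpanGT R t.foliage := by
  induction t using FreeMagma.rec with
  | of x =>
    simp [FreeMagma.bracketing, FreeMagma.foliage, FreeLieAlgebra.toFreeAlgebra,
      FreeAlgebra.word_singleton]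
  | mul a b iha ihb =>
    have ht' := ht.isLyndon
    obtain ⟨ha, hb, h, -⟩ := FreeMagma.IsHall.mul_iff.1 ht
    replace iha := iha ha
    replace ihb := ihb hb
    have ga := add_mem (wordSpanGT_le_wordSpanGE R _ iha) (word_mem_wordSpanGE R a.foliage)
    have gb := add_mem (wordSpanGT_le_wordSpanGE R _ ihb) (word_mem_wordSpanGE R b.foliage)
    rw [sub_add_cancel] at ga gb
    have hlt : a.foliage ++ b.foliage < b.foliage ++ a.foliage :=
      (ht'.2 _ _ rfl a.foliage_ne_nil b.foliage_ne_nil).trans_le (List.self_le_append _ _)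
    have h1 : wordSpanGE R (b.foliage ++ a.foliage) ≤ wordSpanGT R (a.foliage ++ b.foliage) := by
      refine Submodule.span_mono (Set.image_mono fun l hl => ⟨?_, hlt.trans_le hl.2⟩)
      rw [hl.1, List.length_append, List.length_append, add_comm]
    change FreeLieAlgebra.toFreeAlgebra R ⁅a.bracketing R, b.bracketing R⁆ -
      FreeAlgebra.word R (a.foliage ++ b.foliage) ∈ wordSpanGT R (a.foliage ++ b.foliage)
    rw [LieHom.map_lie, FreeAlgebra.word_append, LieRing.of_associative_ring_bracket]
    have e := sub_mem (add_mem (mul_mem_wordSpanGT_left iha gb)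
      (mul_mem_wordSpanGT_right (word_mem_wordSpanGE R _) ihb)) (h1 (mul_mem_wordSpanGE gb ga))
    convert e using 1
    noncomm_ring

end Triangular

/-- The canonical morphism from a free Lie algebra on a finite set to the free associative algebra
is a split monomorphism of modules. The retraction is determined, by descending recursion on words,
from the requirement that it sends the image of the bracket of each Hall tree back to this bracket
and that it vanishes on all other words. -/
theorem FreeLieAlgebra.exists_retraction (R : Type*) [CommRing R] (X : Type*) [LinearOrder X]
    [Finite X] : ∃ r : FreeAlgebra R X →ₗ[R] FreeLieAlgebra R X,
      ∀ z, r (FreeLieAlgebra.toFreeAlgebra R z) = z := by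
  classical
  let rel : List X → List X → Prop := fun l' l => l'.length = l.length ∧ l < l'
  -- there are only finitely many words of each length
  have wf : WellFounded rel := by
    refine ⟨fun l => ?_⟩
    obtain ⟨n, hn⟩ : ∃ n, l.length = n := ⟨_, rfl⟩
    have : Finite {l : List X // l.length = n} := List.finite_length_eq X n
    obtain ⟨w, hw⟩ : ∃ w : {l : List X // l.length = n}, w.1 = l := ⟨⟨l, hn⟩, rfl⟩
    induction w using WellFoundedGT.induction generalizing l with
    | _ w ih =>
    refine ⟨_, fun l' hl' => ih ⟨l', hl'.1.trans hn⟩ ?_ l' (hl'.1.trans hn) rfl⟩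
    change w.1 < l'
    rw [hw]
    exact hl'.2
  let B := FreeAlgebra.basisFreeMonoid R X
  let F : (l : List X) → ((l' : List X) → rel l' l → FreeLieAlgebra R X) → FreeLieAlgebra R X :=
    fun l rec => if h : ∃ t : FreeMagma X, t.IsHall ∧ t.foliage = l then
      h.choose.bracketing R - (B.repr (FreeLieAlgebra.toFreeAlgebra R (h.choose.bracketing R) -
        FreeAlgebra.word R l)).sum fun l' c =>
          if h' : rel (FreeMonoid.toList l') l then c • rec _ h' else 0
      else 0
  let g := wf.fix F
  let r := B.constr R (fun l => g (FreeMonoid.toList l))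
  have hr : ∀ y, r y = (B.repr y).sum fun l' c => c • g (FreeMonoid.toList l') := fun y => by
    simp [r, Module.Basis.constr_apply]
  refine ⟨r, fun z => ?_⟩
  have hz : z ∈ Submodule.span R {z | ∃ t : FreeMagma X, t.IsHall ∧ t.bracketing R = z} := by
    rw [FreeLieAlgebra.span_bracketing_isHall]
    trivial
  induction hz using Submodule.span_induction with
  | zero => simp
  | add x y _ _ hx hy => rw [map_add, map_add, hx, hy]
  | smul c x _ hx => rw [map_smul, map_smul, hx]
  | mem x hx =>
    obtain ⟨t, ht, rfl⟩ := hx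
    have h : ∃ s : FreeMagma X, s.IsHall ∧ s.foliage = t.foliage := ⟨t, ht, rfl⟩
    have hst : h.choose = t := h.choose_spec.1.foliage_injective ht h.choose_spec.2
    have h1 : r (FreeAlgebra.word R t.foliage) = g t.foliage := by
      simp [r, FreeAlgebra.word, B]
    have h2 := ht.toFreeAlgebra_bracketing_sub_mem R
    set d := FreeLieAlgebra.toFreeAlgebra R (t.bracketing R) - FreeAlgebra.word R t.foliage with hd
    have h3 : g t.foliage = t.bracketing R - r d := by
      rw [show g t.foliage = F t.foliage fun l' _ => g l' from wf.fix_eq F _, hr]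
      simp only [F]
      rw [dif_pos h, hst, ← hd]
      congr 1
      refine Finsupp.sum_congr fun l hl => dif_pos ?_
      have h4 : ((B.repr d).support : Set (FreeMonoid X)) ⊆ _ := (B.mem_span_image (m := d)
        (s := FreeMonoid.ofList '' {l' | l'.length = t.foliage.length ∧ t.foliage < l'})).1 ?_
      · obtain ⟨l', hl', rfl⟩ := h4 hl
        exact hl'
      · rw [Set.image_image]
        exact h2
    rw [show FreeLieAlgebra.toFreeAlgebra R (t.bracketing R) = d + FreeAlgebra.word R t.foliage by
      rw [hd, sub_add_cancel], map_add, h1, h3]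
    abel

/-! ### The free Lie ring -/

namespace FreeLieRing

variable {X : Type*} {L : Type*} [LieRing L]

/-- The morphism of Lie rings out of the free Lie ring given by the images of the generators. Unlike
for `FreeLieAlgebra.lift ℤ`, the `ℤ`-module structure on the source is the one of its additive
group, the instance found by default. -/
noncomputable def lift (f : X → L) : FreeLieAlgebra ℤ X →ₗ⁅ℤ⁆ L := FreeLieAlgebra.lift ℤ f

theorem lift_of (f : X → L) (x : X) : lift f (FreeLieAlgebra.of ℤ x) = f x :=
  FreeLieAlgebra.lift_of_apply f x

theorem hom_ext {f g : FreeLieAlgebra ℤ X →ₗ⁅ℤ⁆ L}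
    (h : ∀ x, f (FreeLieAlgebra.of ℤ x) = g (FreeLieAlgebra.of ℤ x)) : f = g :=
  FreeLieAlgebra.hom_ext (R := ℤ) h

theorem hom_congr {f g : FreeLieAlgebra ℤ X →ₗ⁅ℤ⁆ L}
    (h : ∀ x, f (FreeLieAlgebra.of ℤ x) = g (FreeLieAlgebra.of ℤ x)) (z : FreeLieAlgebra ℤ X) :
    f z = g z := by
  rw [hom_ext h]

theorem exists_retraction (X : Type*) [LinearOrder X] [Finite X] :
    ∃ r : FreeAlgebra ℤ X →+ FreeLieAlgebra ℤ X, ∀ z, r (lift (FreeAlgebra.ι ℤ) z) = z := by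
  obtain ⟨r, hr⟩ := FreeLieAlgebra.exists_retraction ℤ X
  exact ⟨r.toAddMonoidHom, hr⟩

end FreeLieRing

/-! ### Leading coefficients in unit groups of power series -/

section LeadingCoefficient

open PowerSeries

variable {R : Type*} [Ring R] {G : Type*} [Group G]

theorem PowerSeries.coeff_one_add_X_pow_mul (p : ℕ+) (u : PowerSeries R) :
    coeff (p : ℕ) (1 + X ^ (p : ℕ) * u) = constantCoeff u := by
  have h := coeff_X_pow_mul u (p : ℕ) 0
  rw [zero_add] at h
  rw [map_add, h, coeff_one, if_neg p.ne_zero, zero_add, coeff_zero_eq_constantCoeff_apply]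

/-- For `a = 1 + t^p u` and `b = 1 + t^q v` with `t` central,
`a b a⁻¹ b⁻¹ = 1 + t^(p+q) (u v - v u) (b a)⁻¹`. -/
theorem PowerSeries.coe_commutatorElement_units {a b : (PowerSeries R)ˣ} {p q : ℕ}
    {u v : PowerSeries R} (ha : (a : PowerSeries R) = 1 + X ^ p * u)
    (hb : (b : PowerSeries R) = 1 + X ^ q * v) :
    ((⁅a, b⁆ : (PowerSeries R)ˣ) : PowerSeries R) =
      1 + X ^ (p + q) * ((u * v - v * u) * ((b * a)⁻¹ : (PowerSeries R)ˣ).val) := by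
  have h1 : (a : PowerSeries R) * (b : PowerSeries R) =
      (b : PowerSeries R) * (a : PowerSeries R) + X ^ (p + q) * (u * v - v * u) := by
    have e1 : X ^ p * u * (X ^ q * v) = X ^ (p + q) * (u * v) := by
      rw [mul_assoc, ← mul_assoc u, (commute_X_pow u q).eq, mul_assoc, ← mul_assoc, pow_add]
    have e2 : X ^ q * v * (X ^ p * u) = X ^ (p + q) * (v * u) := by
      rw [mul_assoc, ← mul_assoc v, (commute_X_pow v p).eq, mul_assoc, ← mul_assoc, ← pow_add,
        add_comm q p]
    rw [ha, hb, mul_sub, ← e1, ← e2]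
    noncomm_ring
  have h2 : ⁅a, b⁆ = (a * b) * (b * a)⁻¹ := by
    rw [commutatorElement_def, mul_inv_rev]
    group
  rw [h2, Units.val_mul, Units.val_mul, h1, add_mul, ← Units.val_mul b a, Units.mul_inv, mul_assoc]

/-- The filtration of a group `G` induced by a homomorphism `M` into the power series with
constant coefficient `1`: the `p`-th term consists of the `g` with `M g ≡ 1` modulo `t^p`. -/
def powerSeriesFiltration (M : G →* (PowerSeries R)ˣ)
    (hM : ∀ g, constantCoeff (M g : PowerSeries R) = 1) : CentralFiltration G where
  sub p :=
    { carrier := {g | ∃ u, (M g : PowerSeries R) = 1 + X ^ (p : ℕ) * u}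
      one_mem' := ⟨0, by simp⟩
      mul_mem' := by
        rintro g h ⟨u, hu⟩ ⟨v, hv⟩
        refine ⟨u + v + u * (X ^ (p : ℕ) * v), ?_⟩
        rw [map_mul, Units.val_mul, hu, hv]
        noncomm_ring
      inv_mem' := by
        rintro g ⟨u, hu⟩
        refine ⟨-(u * (M g⁻¹ : (PowerSeries R)ˣ)), ?_⟩
        have h : (M g : PowerSeries R) * (M g⁻¹ : (PowerSeries R)ˣ) = 1 := by
          rw [map_inv, Units.mul_inv]
        rw [hu, add_mul, one_mul] at h
        rw [mul_neg, ← mul_assoc, ← sub_eq_add_neg, eq_sub_iff_add_eq, h] }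
  sub_one := by
    refine eq_top_iff.2 fun g _ => ?_
    have h : X ∣ (M g : PowerSeries R) - 1 := by
      rw [X_dvd_iff, map_sub, hM, map_one, sub_self]
    obtain ⟨u, hu⟩ := h
    exact ⟨u, by rw [PNat.one_coe, pow_one, ← hu, add_sub_cancel]⟩
  sub_succ_le p := by
    rintro g ⟨u, hu⟩
    exact ⟨X * u, by rw [hu, PNat.add_coe, PNat.one_coe, pow_succ, mul_assoc]⟩
  commutator_le p q := by
    rw [Subgroup.commutator_le]
    rintro g ⟨u, hu⟩ h ⟨v, hv⟩
    refine ⟨(u * v - v * u) * ((M h * M g)⁻¹ : (PowerSeries R)ˣ).val, ?_⟩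
    rw [map_commutatorElement, PNat.add_coe]
    exact coe_commutatorElement_units hu hv

variable (M : G →* (PowerSeries R)ˣ) (hM : ∀ g, constantCoeff (M g : PowerSeries R) = 1)

/-- The additive map which sends the class of `g` with `M g = 1 + c t^p + ⋯` to `c`. -/
noncomputable def leadingCoeffAux : (powerSeriesFiltration M hM).Gr →+ R :=
  DirectSum.toAddMonoid fun p => (powerSeriesFiltration M hM).pieceLift p
    (fun g => coeff (p : ℕ) (M g : PowerSeries R))
    (fun g h => by
      obtain ⟨u, hu⟩ := g.2
      obtain ⟨v, hv⟩ := h.2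
      have e : (M (g * h : (powerSeriesFiltration M hM).sub p) : PowerSeries R) =
          1 + X ^ (p : ℕ) * (u + v + u * (X ^ (p : ℕ) * v)) := by
        rw [Subgroup.coe_mul, map_mul, Units.val_mul, hu, hv]
        noncomm_ring
      rw [e, hu, hv]
      simp [coeff_one_add_X_pow_mul])
    (fun g hg => by
      obtain ⟨u, hu⟩ := hg
      rw [PNat.add_coe, PNat.one_coe, pow_succ, mul_assoc] at hu
      rw [hu, coeff_one_add_X_pow_mul]
      simp)

theorem leadingCoeffAux_cls (p : ℕ+) (g : (powerSeriesFiltration M hM).sub p) :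
    leadingCoeffAux M hM ((powerSeriesFiltration M hM).cls p g) =
      coeff (p : ℕ) (M g : PowerSeries R) := by
  change DirectSum.toAddMonoid _ (DirectSum.of (powerSeriesFiltration M hM).Piece p _) = _
  rw [DirectSum.toAddMonoid_of, CentralFiltration.pieceLift_toPiece]

/-- The morphism of Lie rings which sends the class of `g` with `M g = 1 + c t^p + ⋯` to `c`. -/
noncomputable def leadingCoeff : (powerSeriesFiltration M hM).Gr →ₗ⁅ℤ⁆ R :=
  { (leadingCoeffAux M hM).toIntLinearMap with
    map_lie' := by
      intro a b
      change leadingCoeffAux M hM ⁅a, b⁆ = ⁅leadingCoeffAux M hM a, leadingCoeffAux M hM b⁆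
      induction a using CentralFiltration.gr_induction with
      | h0 => rw [zero_lie, map_zero, zero_lie]
      | ha a a' h h' => rw [add_lie, map_add, map_add, add_lie, h, h']
      | hc p x =>
        induction b using CentralFiltration.gr_induction with
        | h0 => rw [lie_zero, map_zero, lie_zero]
        | ha a a' h h' => rw [lie_add, map_add, map_add, lie_add, h, h']
        | hc q y =>
          obtain ⟨u, hu⟩ := x.2
          obtain ⟨v, hv⟩ := y.2
          rw [CentralFiltration.cls_lie, leadingCoeffAux_cls, leadingCoeffAux_cls,
            leadingCoeffAux_cls, map_commutatorElement, coe_commutatorElement_units hu hv,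
            ← PNat.add_coe, coeff_one_add_X_pow_mul, hu, hv, coeff_one_add_X_pow_mul,
            coeff_one_add_X_pow_mul, ← map_mul M, ← map_inv M, map_mul constantCoeff, hM,
            mul_one, map_sub, map_mul, map_mul, LieRing.of_associative_ring_bracket] }

theorem leadingCoeff_cls (p : ℕ+) (g : (powerSeriesFiltration M hM).sub p) :
    leadingCoeff M hM ((powerSeriesFiltration M hM).cls p g) =
      coeff (p : ℕ) (M g : PowerSeries R) :=
  leadingCoeffAux_cls M hM p g

end LeadingCoefficient

/-! ### The lower central series of a free group -/

section Witt

variable (X : Type*)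

/-- The canonical morphism from the free Lie algebra over `ℤ` to the Lie ring of the descending
central series of the free group, on any set of generators. -/
noncomputable def wittHom : FreeLieAlgebra ℤ X →ₗ⁅ℤ⁆ GrDCS (FreeGroup X) :=
  FreeLieRing.lift fun i => (dcs (FreeGroup X)).cls 1 ⟨FreeGroup.of i, Subgroup.mem_top _⟩

variable {X}

theorem wittHom_of (i : X) : wittHom X (FreeLieAlgebra.of ℤ i) =
    (dcs (FreeGroup X)).cls 1 ⟨FreeGroup.of i, Subgroup.mem_top _⟩ :=
  FreeLieRing.lift_of _ _

theorem wittHom_map {Y : Type*} (f : X → Y) (z : FreeLieAlgebra ℤ X) :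
    wittHom Y (FreeLieRing.lift (fun x => FreeLieAlgebra.of ℤ (f x)) z) =
      grDCSMap (dcs (FreeGroup Y)) (FreeGroup.map f) (wittHom X z) := by
  refine FreeLieRing.hom_congr (f := (wittHom Y).comp (FreeLieRing.lift _))
    (g := (grDCSMap (dcs (FreeGroup Y)) (FreeGroup.map f)).comp (wittHom X)) (fun x => ?_) z
  rw [LieHom.comp_apply, LieHom.comp_apply, FreeLieRing.lift_of, wittHom_of, wittHom_of,
    grDCSMap, CentralFiltration.grMap_cls]
  congr 1

/-- The Magnus expansion `x_i ↦ 1 + X_i t`, with values in the power series in a central variable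
`t` over the free associative algebra. -/
noncomputable def magnus : FreeGroup X →* (PowerSeries (FreeAlgebra ℤ X))ˣ :=
  FreeGroup.lift fun x =>
    { val := 1 + PowerSeries.X * PowerSeries.C (FreeAlgebra.ι ℤ x)
      inv := PowerSeries.invOfUnit (1 + PowerSeries.X * PowerSeries.C (FreeAlgebra.ι ℤ x)) 1
      val_inv := PowerSeries.mul_invOfUnit _ _ (by simp)
      inv_val := PowerSeries.invOfUnit_mul _ _ (by simp) }

theorem magnus_of (x : X) : (magnus (FreeGroup.of x) : PowerSeries (FreeAlgebra ℤ X)) =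
    1 + PowerSeries.X * PowerSeries.C (FreeAlgebra.ι ℤ x) := by
  simp [magnus]

theorem constantCoeff_magnus (g : FreeGroup X) :
    PowerSeries.constantCoeff (magnus g : PowerSeries (FreeAlgebra ℤ X)) = 1 := by
  have h : (Units.map (PowerSeries.constantCoeff (R := FreeAlgebra ℤ X)).toMonoidHom).comp magnus =
      1 := by
    ext x
    simp [magnus_of]
  exact congrArg Units.val (DFunLike.congr_fun h g)

/-- The morphism of Lie rings from the graded Lie ring of a free group to the free associative
algebra given by the leading terms of Magnus expansions. -/
noncomputable def magnusLie : GrDCS (FreeGroup X) →ₗ⁅ℤ⁆ FreeAlgebra ℤ X :=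
  (leadingCoeff magnus constantCoeff_magnus).comp
    (grDCSMap (powerSeriesFiltration magnus constantCoeff_magnus) (MonoidHom.id _))

theorem magnusLie_wittHom (z : FreeLieAlgebra ℤ X) :
    magnusLie (wittHom X z) = FreeLieRing.lift (FreeAlgebra.ι ℤ) z := by
  refine FreeLieRing.hom_congr (f := magnusLie.comp (wittHom X)) (fun x => ?_) z
  rw [LieHom.comp_apply, wittHom_of, magnusLie, LieHom.comp_apply, grDCSMap,
    CentralFiltration.grMap_cls, leadingCoeff_cls, FreeLieRing.lift_of]
  change PowerSeries.coeff 1 (magnus (FreeGroup.of x) : PowerSeries (FreeAlgebra ℤ X)) = _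
  rw [magnus_of]
  simp [PowerSeries.coeff_one]

theorem wittHom_injective [LinearOrder X] [Finite X] : Function.Injective (wittHom X) := by
  obtain ⟨r, hr⟩ := FreeLieRing.exists_retraction X
  refine Function.LeftInverse.injective (g := fun z => r (magnusLie z)) fun z => ?_
  change r (magnusLie (wittHom X z)) = z
  rw [magnusLie_wittHom, hr]

/-- The classes of the elements of `Γ^p` of a free group come from the free Lie algebra. The
preimages can be taken in `P p` for any sequence `P` of additive subgroups such that `P 1` contains
the generators and `[P p, P 1] ⊆ P (p + 1)`. -/
theorem exists_wittHom_eq_cls (P : ℕ+ → AddSubgroup (FreeLieAlgebra ℤ X))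
    (hof : ∀ i, FreeLieAlgebra.of ℤ i ∈ P 1)
    (hlie : ∀ p, ∀ y z, y ∈ P p → z ∈ P 1 → ⁅y, z⁆ ∈ P (p + 1)) (p : ℕ+)
    (g : (dcs (FreeGroup X)).sub p) : ∃ z ∈ P p, wittHom X z = (dcs (FreeGroup X)).cls p g := by
  have one : ∀ p : ℕ+, ∃ z ∈ P p, wittHom X z = (dcs (FreeGroup X)).cls p 1 := fun p =>
    ⟨0, zero_mem _, by rw [map_zero, CentralFiltration.cls_one]⟩
  have inv : ∀ (p : ℕ+) (g : (dcs (FreeGroup X)).sub p),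
      (∃ z ∈ P p, wittHom X z = (dcs (FreeGroup X)).cls p g) →
      ∃ z ∈ P p, wittHom X z = (dcs (FreeGroup X)).cls p g⁻¹ := by
    rintro p g ⟨z, hz, e⟩
    refine ⟨-z, neg_mem hz, ?_⟩
    rw [map_neg, e, neg_eq_iff_add_eq_zero, ← CentralFiltration.cls_mul, mul_inv_cancel,
      CentralFiltration.cls_one]
  have mul : ∀ (p : ℕ+) (g h : (dcs (FreeGroup X)).sub p),
      (∃ z ∈ P p, wittHom X z = (dcs (FreeGroup X)).cls p g) →
      (∃ z ∈ P p, wittHom X z = (dcs (FreeGroup X)).cls p h) →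
      ∃ z ∈ P p, wittHom X z = (dcs (FreeGroup X)).cls p (g * h) := by
    rintro p g h ⟨z, hz, e⟩ ⟨z', hz', e'⟩
    exact ⟨z + z', add_mem hz hz', by rw [map_add, e, e', ← CentralFiltration.cls_mul]⟩
  have deg_one : ∀ g : FreeGroup X, ∃ z ∈ P 1, wittHom X z =
      (dcs (FreeGroup X)).cls 1 ⟨g, Subgroup.mem_top _⟩ := by
    intro g
    induction g using FreeGroup.induction_on with
    | C1 => exact one 1
    | of i =>
      exact ⟨FreeLieAlgebra.of ℤ i, hof i, wittHom_of i⟩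
    | inv_of i h => exact inv 1 _ h
    | mul x y hx hy => exact mul 1 _ _ hx hy
  induction p using PNat.recOn with
  | one => exact deg_one g.1
  | succ p ih =>
    obtain ⟨g, hg'⟩ := g
    have hg : g ∈ Gam (FreeGroup X) (p + 1) := hg'
    have hle : ⁅Gam (FreeGroup X) p, ⊤⁆ ≤ Gam (FreeGroup X) (p + 1) := (Gam_succ _ _).ge
    rw [Gam_succ, Subgroup.commutator_def] at hg
    induction hg using Subgroup.closure_induction with
    | one => exact one (p + 1)
    | inv x hx h => exact inv (p + 1) ⟨x, hle hx⟩ (h _)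
    | mul x y hx hy h h' => exact mul (p + 1) ⟨x, hle hx⟩ ⟨y, hle hy⟩ (h _) (h' _)
    | mem x hx =>
      obtain ⟨a, ha, b, -, rfl⟩ := hx
      obtain ⟨y, hy, ey⟩ := ih ⟨a, ha⟩
      obtain ⟨z, hz, ez⟩ := deg_one b
      refine ⟨⁅y, z⁆, ?_, ?_⟩
      · exact hlie p y z hy hz
      · rw [LieHom.map_lie, ey, ez, CentralFiltration.cls_lie]

theorem wittHom_surjective : Function.Surjective (wittHom X) := by
  intro a
  induction a using CentralFiltration.gr_induction with
  | h0 => exact ⟨0, map_zero _⟩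
  | hc p g =>
    obtain ⟨z, -, hz⟩ := exists_wittHom_eq_cls (fun _ => ⊤) (fun _ => trivial)
      (fun _ _ _ _ _ => trivial) p g
    exact ⟨z, hz⟩
  | ha a b h h' =>
    obtain ⟨z, rfl⟩ := h
    obtain ⟨z', rfl⟩ := h'
    exact ⟨z + z', map_add _ _ _⟩

end Witt

/-! ### Graded pieces of the free Lie algebra -/

theorem CentralFiltration.cls_zpow {G : Type*} [Group G] (N : CentralFiltration G) (p : ℕ+)
    (g : N.sub p) (c : ℤ) : N.cls p (g ^ c) = c • N.cls p g :=
  map_zpow (MonoidHom.mk' (fun g => Multiplicative.ofAdd (N.cls p g)) fun g h =>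
    congrArg Multiplicative.ofAdd (N.cls_mul p g h)) g c

section Pieces

variable {n : ℕ}

theorem of_mem_LPiece (i : Fin n) : FreeLieAlgebra.of ℤ i ∈ LPiece n 1 := by
  rw [LPiece]
  exact Submodule.subset_span ⟨i, rfl⟩

theorem lie_mem_LPiece {s : ℕ} {x y : LV n} (hs : 1 ≤ s) (hx : x ∈ LPiece n 1)
    (hy : y ∈ LPiece n s) : ⁅x, y⁆ ∈ LPiece n (s + 1) := by
  rw [LPiece] at hx
  induction hx using Submodule.span_induction with
  | mem x hx =>
    obtain ⟨i, rfl⟩ := hx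
    obtain ⟨s, rfl⟩ := Nat.exists_eq_add_of_le' hs
    rw [LPiece]
    exact Submodule.subset_span ⟨i, y, hy, rfl⟩
  | zero => rw [zero_lie]; exact zero_mem _
  | add x x' _ _ h h' => rw [add_lie]; exact add_mem h h'
  | smul c x _ h => rw [zsmul_lie]; exact zsmul_mem h c

/-- Every class in `Γ^p(F_n) / Γ^{p+1}(F_n)` comes from `L_p[V_n]`. -/
theorem exists_mem_LPiece (p : ℕ+) (g : (dcs (Fr n)).sub p) :
    ∃ z ∈ LPiece n p, wittMap n z = (dcs (Fr n)).cls p g := by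
  refine exists_wittHom_eq_cls (fun p => (LPiece n p).toAddSubgroup) of_mem_LPiece ?_ p g
  intro p y z hy hz
  rw [← lie_skew]
  exact neg_mem (lie_mem_LPiece p.pos hz hy)

/-- The elements of `L_p[V_n]` map to classes in `Γ^p(F_n) / Γ^{p+1}(F_n)`. -/
theorem exists_cls_eq_of_mem_LPiece (p : ℕ+) {z : LV n} (hz : z ∈ LPiece n p) :
    ∃ g, wittMap n z = (dcs (Fr n)).cls p g := by
  let S : ℕ+ → Submodule ℤ (LV n) := fun p =>
    { carrier := {z | ∃ g, wittMap n z = (dcs (Fr n)).cls p g}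
      zero_mem' := ⟨1, by rw [map_zero, CentralFiltration.cls_one]⟩
      add_mem' := by
        rintro x y ⟨g, hg⟩ ⟨h, hh⟩
        exact ⟨g * h, by rw [map_add, hg, hh, CentralFiltration.cls_mul]⟩
      smul_mem' := by
        rintro c x ⟨g, hg⟩
        exact ⟨g ^ c, by rw [map_zsmul, hg, CentralFiltration.cls_zpow]⟩ }
  change z ∈ S p
  suffices h : LPiece n p ≤ S p from h hz
  clear hz
  induction p using PNat.recOn with
  | one =>
    rw [PNat.one_coe, LPiece, Submodule.span_le]
    rintro _ ⟨i, rfl⟩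
    exact ⟨_, wittHom_of i⟩
  | succ p ih =>
    obtain ⟨s, hs⟩ := Nat.exists_eq_add_of_le' p.pos
    rw [PNat.add_coe, PNat.one_coe, hs, LPiece, Submodule.span_le, ← hs]
    rintro _ ⟨i, y, hy, rfl⟩
    obtain ⟨g, hg⟩ := ih hy
    refine ⟨⟨⁅FreeGroup.of i, (g : Fr n)⁆, ?_⟩, ?_⟩
    · rw [add_comm]
      exact (dcs (Fr n)).comm_mem (p := 1) (Subgroup.mem_top _) g.2
    · rw [LieHom.map_lie, hg, show wittMap n (FreeLieAlgebra.of ℤ i) = _ from wittHom_of i,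
        CentralFiltration.cls_lie]
      exact CentralFiltration.cls_congr _ (add_comm _ _) rfl

theorem wittMap_bijective : Function.Bijective (wittMap n) :=
  ⟨wittHom_injective, wittHom_surjective⟩

end Pieces

/-! ### The Johnson homomorphisms -/

section Johnson

variable {n : ℕ}

/-- The semidirect product `F_n ⋊ IA_n`. -/
abbrev FrIA (n : ℕ) : Type := Fr n ⋊[(IA n).subtype] IA n

theorem mk_apply_eq_of_mem {p s : ℕ+} {φ : IA n} (hφ : φ ∈ (johnsonFiltration n).sub s)
    {b : Fr n} (hb : b ∈ Gam (Fr n) p) {q : ℕ+} (hq : q ≤ p + s) :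
    (QuotientGroup.mk (φ.1 b) : Fr n ⧸ Gam (Fr n) q) = QuotientGroup.mk b := by
  rw [← mul_inv_eq_one, ← QuotientGroup.mk_inv, ← QuotientGroup.mk_mul, QuotientGroup.eq_one_iff]
  exact (dcs (Fr n)).le_of_le hq (johnson_div_mem_of_mem hφ p hb)

/-- The strongly central filtration of `F_n ⋊ IA_n` whose `p`-th term is
`Γ^p(F_n) ⋊ J_n^p`. -/
def semidirectFiltration (n : ℕ) : CentralFiltration (FrIA n) where
  sub p :=
    { carrier := {x | x.left ∈ Gam (Fr n) p ∧ x.right ∈ (johnsonFiltration n).sub p}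
      one_mem' := ⟨one_mem _, one_mem _⟩
      mul_mem' := fun {x y} hx hy => ⟨mul_mem hx.1
        (map_mem_of_mem_Gam (dcs (Fr n)) x.right.1.toMonoidHom p _ hy.1), mul_mem hx.2 hy.2⟩
      inv_mem' := fun {x} hx => ⟨map_mem_of_mem_Gam (dcs (Fr n)) (x.right⁻¹).1.toMonoidHom p _
        (inv_mem hx.1), inv_mem hx.2⟩ }
  sub_one := by
    refine eq_top_iff.2 fun x _ => ⟨Subgroup.mem_top _, ?_⟩
    rw [(johnsonFiltration n).sub_one]
    exact Subgroup.mem_top _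
  sub_succ_le p x hx := ⟨(dcs (Fr n)).sub_succ_le p hx.1, (johnsonFiltration n).sub_succ_le p hx.2⟩
  commutator_le p q := by
    rw [Subgroup.commutator_le]
    intro x hx y hy
    have hr : ⁅x.right, y.right⁆ ∈ (johnsonFiltration n).sub (p + q) :=
      (johnsonFiltration n).comm_mem hx.2 hy.2
    refine ⟨?_, hr⟩
    have e := congrArg SemidirectProduct.left (show ⁅x, y⁆ * (y * x) = x * y by
      rw [commutatorElement_def]; group)
    have e2 : ⁅x, y⁆.right = ⁅x.right, y.right⁆ := rfl
    simp only [SemidirectProduct.mul_left, e2] at e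
    let π := QuotientGroup.mk' (Gam (Fr n) (p + q))
    have h1 : ∀ z, π (⁅x.right, y.right⁆.1 z) = π z := fun z =>
      mk_apply_eq_of_mem hr (p := 1) (Subgroup.mem_top z) (PNat.lt_add_left _ _).le
    have h2 : π (x.right.1 y.left) = π y.left :=
      mk_apply_eq_of_mem hx.2 hy.1 (add_comm p q).le
    have h3 : π (y.right.1 x.left) = π x.left := mk_apply_eq_of_mem hy.2 hx.1 le_rfl
    have h4 : π ⁅x.left, y.left⁆ = 1 :=
      (QuotientGroup.eq_one_iff _).2 ((dcs (Fr n)).comm_mem hx.1 hy.1)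
    have e3 := congrArg π e
    change π (⁅x, y⁆.left * ⁅x.right, y.right⁆.1 (y.left * y.right.1 x.left)) =
      π (x.left * x.right.1 y.left) at e3
    rw [map_mul, h1, map_mul, map_mul, h2, h3] at e3
    rw [← QuotientGroup.eq_one_iff]
    change π _ = 1
    rw [← h4, map_commutatorElement, commutatorElement_def (π x.left), eq_mul_inv_iff_mul_eq,
      eq_mul_inv_iff_mul_eq, mul_assoc, e3]

theorem inl_mem_semidirectFiltration (p : ℕ+) (g : Fr n) (hg : g ∈ (dcs (Fr n)).sub p) :
    (SemidirectProduct.inl g : FrIA n) ∈ (semidirectFiltration n).sub p :=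
  ⟨hg, one_mem _⟩

theorem inr_mem_semidirectFiltration (p : ℕ+) (φ : IA n) (hφ : φ ∈ (johnsonFiltration n).sub p) :
    (SemidirectProduct.inr φ : FrIA n) ∈ (semidirectFiltration n).sub p :=
  ⟨one_mem _, hφ⟩

/-- The morphism `gr(F_n) → gr(F_n ⋊ IA_n)` induced by the inclusion. -/
noncomputable def grInl (n : ℕ) : GrDCS (Fr n) →ₗ⁅ℤ⁆ (semidirectFiltration n).Gr :=
  CentralFiltration.grMap SemidirectProduct.inl inl_mem_semidirectFiltration

/-- The morphism `gr^J(IA_n) → gr(F_n ⋊ IA_n)` induced by the inclusion. -/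
noncomputable def grInr (n : ℕ) : GrJ n →ₗ⁅ℤ⁆ (semidirectFiltration n).Gr :=
  CentralFiltration.grMap SemidirectProduct.inr inr_mem_semidirectFiltration

/-- The additive projection `gr(F_n ⋊ IA_n) → gr(F_n)`. -/
noncomputable def grLeft (n : ℕ) : (semidirectFiltration n).Gr →+ GrDCS (Fr n) :=
  DirectSum.toAddMonoid fun p => (semidirectFiltration n).pieceLift p
    (fun x => (dcs (Fr n)).cls p ⟨x.1.left, x.2.1⟩)
    (fun x y => by
      have hy : x.1.right.1 y.1.left ∈ (dcs (Fr n)).sub p :=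
        map_mem_of_mem_Gam (dcs (Fr n)) x.1.right.1.toMonoidHom p _ y.2.1
      have h : (dcs (Fr n)).cls p ⟨y.1.left, y.2.1⟩ = (dcs (Fr n)).cls p ⟨_, hy⟩ := by
        have h1 : x.1.right ∈ (johnsonFiltration n).sub 1 := by
          rw [(johnsonFiltration n).sub_one]
          exact Subgroup.mem_top _
        unfold CentralFiltration.cls
        congr 1
        rw [CentralFiltration.toPiece_eq_iff]
        exact QuotientGroup.eq.1 (mk_apply_eq_of_mem h1 y.2.1 le_rfl).symm
      rw [h, ← CentralFiltration.cls_mul]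
      rfl)
    (fun x hx => by
      have h : (dcs (Fr n)).toPiece p ⟨x.1.left, x.2.1⟩ = 0 :=
        (dcs (Fr n)).toPiece_eq_zero_iff.2 hx.1
      rw [CentralFiltration.cls, h]
      exact map_zero (DirectSum.of (dcs (Fr n)).Piece p))

theorem grLeft_cls (p : ℕ+) (x : (semidirectFiltration n).sub p) :
    grLeft n ((semidirectFiltration n).cls p x) = (dcs (Fr n)).cls p ⟨x.1.left, x.2.1⟩ := by
  change DirectSum.toAddMonoid _ (DirectSum.of (semidirectFiltration n).Piece p _) = _
  rw [DirectSum.toAddMonoid_of, CentralFiltration.pieceLift_toPiece]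

theorem grInl_injective : Function.Injective (grInl n) := by
  refine Function.LeftInverse.injective (g := grLeft n) fun a => ?_
  induction a using CentralFiltration.gr_induction with
  | h0 => rw [map_zero, map_zero]
  | ha a b h h' => rw [map_add, map_add, h, h']
  | hc p g => rw [grInl, CentralFiltration.grMap_cls, grLeft_cls]; rfl

/-- For `φ` in `J_n^s` and `g` in `Γ^p(F_n)`, the element `φ(g) g⁻¹` of `Γ^{p+s}(F_n)`. -/
def displacement {s p : ℕ+} (φ : (johnsonFiltration n).sub s) (g : (dcs (Fr n)).sub p) :
    (dcs (Fr n)).sub (p + s) :=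
  ⟨φ.1.1 g.1 * g.1⁻¹, johnson_div_mem_of_mem φ.2 p g.2⟩

/-- In the semidirect product, `φ(g) g⁻¹` is the commutator of `φ` and `g`. -/
theorem lie_grInr_cls_grInl_cls {s p : ℕ+} (φ : (johnsonFiltration n).sub s)
    (g : (dcs (Fr n)).sub p) :
    ⁅grInr n ((johnsonFiltration n).cls s φ), grInl n ((dcs (Fr n)).cls p g)⁆ =
      grInl n ((dcs (Fr n)).cls (p + s) (displacement φ g)) := by
  rw [grInr, grInl, CentralFiltration.grMap_cls, CentralFiltration.grMap_cls,
    CentralFiltration.grMap_cls, CentralFiltration.cls_lie]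
  refine CentralFiltration.cls_congr _ (add_comm s p) ?_
  change ⁅(SemidirectProduct.inr φ.1 : FrIA n), SemidirectProduct.inl g.1⁆ =
    SemidirectProduct.inl (φ.1.1 g.1 * g.1⁻¹)
  rw [commutatorElement_def, ← map_inv SemidirectProduct.inr, ← SemidirectProduct.inl_aut,
    map_mul, map_inv]
  rfl

/-- The embedding of `L[V_n]` in `gr(F_n ⋊ IA_n)`. -/
noncomputable def lieInl (n : ℕ) : LV n →ₗ⁅ℤ⁆ (semidirectFiltration n).Gr :=
  (grInl n).comp (wittMap n)

theorem lieInl_injective : Function.Injective (lieInl n) :=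
  grInl_injective.comp wittMap_bijective.1

/-- The image of `L[V_n]` in `gr(F_n ⋊ IA_n)` is stable under the bracket with `gr^J(IA_n)`. -/
theorem exists_lieInl_eq_lie (ξ : GrJ n) (y : LV n) :
    ∃ z, lieInl n z = ⁅grInr n ξ, lieInl n y⁆ := by
  obtain ⟨a, ha⟩ : ∃ a, wittMap n y = a := ⟨_, rfl⟩
  suffices h : ∃ b, grInl n b = ⁅grInr n ξ, grInl n a⁆ by
    obtain ⟨b, hb⟩ := h
    obtain ⟨z, rfl⟩ := wittMap_bijective.2 b
    exact ⟨z, by rw [lieInl, LieHom.comp_apply, LieHom.comp_apply, hb, ha]⟩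
  clear ha
  induction ξ using CentralFiltration.gr_induction with
  | h0 => exact ⟨0, by rw [map_zero, map_zero, zero_lie]⟩
  | ha ξ η h h' =>
    obtain ⟨b, hb⟩ := h
    obtain ⟨b', hb'⟩ := h'
    exact ⟨b + b', by rw [map_add, map_add, add_lie, hb, hb']⟩
  | hc s φ =>
    induction a using CentralFiltration.gr_induction with
    | h0 => exact ⟨0, by rw [map_zero, lie_zero]⟩
    | ha a a' h h' =>
      obtain ⟨b, hb⟩ := h
      obtain ⟨b', hb'⟩ := h'
      exact ⟨b + b', by rw [map_add, map_add, lie_add, hb, hb']⟩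
    | hc p g => exact ⟨_, (lie_grInr_cls_grInl_cls φ g).symm⟩

/-- The derivation of `L[V_n]` given by the bracket with an element of `gr^J(IA_n)` inside
`gr(F_n ⋊ IA_n)`. Its values are chosen preimages under the embedding `lieInl`, which makes them
unique. -/
noncomputable def johnsonDer (ξ : GrJ n) : LieDerivation ℤ (LV n) (LV n) :=
  let act : LV n → LV n := fun y => (exists_lieInl_eq_lie ξ y).choose
  have hact : ∀ y, lieInl n (act y) = ⁅grInr n ξ, lieInl n y⁆ := fun y =>
    (exists_lieInl_eq_lie ξ y).choose_spec
  let F : LV n →+ LV n := AddMonoidHom.mk' act fun x y => lieInl_injective <| by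
    rw [map_add, hact, hact, hact, map_add, lie_add]
  { F.toIntLinearMap with
    leibniz' := fun x y => lieInl_injective <| by
      change lieInl n (act ⁅x, y⁆) = lieInl n (⁅x, act y⁆ - ⁅y, act x⁆)
      rw [map_sub, hact, LieHom.map_lie, LieHom.map_lie, LieHom.map_lie, hact, hact,
        leibniz_lie (grInr n ξ), ← lie_skew (lieInl n y)]
      abel }

theorem lieInl_johnsonDer (ξ : GrJ n) (y : LV n) :
    lieInl n (johnsonDer ξ y) = ⁅grInr n ξ, lieInl n y⁆ :=
  (exists_lieInl_eq_lie ξ y).choose_spec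

theorem wittMap_johnsonDer_cls {s p : ℕ+} (φ : (johnsonFiltration n).sub s) {y : LV n}
    {g : (dcs (Fr n)).sub p} (hy : wittMap n y = (dcs (Fr n)).cls p g) :
    wittMap n (johnsonDer ((johnsonFiltration n).cls s φ) y) =
      (dcs (Fr n)).cls (p + s) (displacement φ g) := by
  apply grInl_injective
  have h := lieInl_johnsonDer ((johnsonFiltration n).cls s φ) y
  rw [lieInl, LieHom.comp_apply, LieHom.comp_apply, hy, lie_grInr_cls_grInl_cls] at h
  exact h

theorem johnsonDer_mem_DerLV (ξ : GrJ n) : johnsonDer ξ ∈ DerLV n := by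
  induction ξ using CentralFiltration.gr_induction with
  | h0 =>
    have h : johnsonDer (0 : GrJ n) = 0 := by
      ext y
      apply lieInl_injective
      rw [lieInl_johnsonDer, map_zero, zero_lie, LieDerivation.zero_apply, map_zero]
    rw [h]
    exact zero_mem _
  | ha ξ η h h' =>
    have e : johnsonDer (ξ + η) = johnsonDer ξ + johnsonDer η := by
      ext y
      apply lieInl_injective
      rw [lieInl_johnsonDer, map_add, add_lie, LieDerivation.add_apply, map_add,
        lieInl_johnsonDer, lieInl_johnsonDer]
    rw [e]
    exact add_mem h h'
  | hc s φ =>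
    refine Submodule.subset_span ⟨s, s.pos, fun p x hx => ?_⟩
    rcases Nat.eq_zero_or_pos p with rfl | hp
    · have h0 : x = 0 := by simpa [LPiece] using hx
      rw [h0, map_zero]
      exact zero_mem _
    · lift p to ℕ+ using hp
      obtain ⟨g, hg⟩ := exists_cls_eq_of_mem_LPiece p hx
      obtain ⟨z, hz, e⟩ := exists_mem_LPiece (p + s) (displacement φ g)
      rw [← wittMap_johnsonDer_cls φ hg] at e
      rw [← wittMap_bijective.1 e]
      exact hz

/-- The morphism of Lie rings from `gr^J(IA_n)` to the derivations of `L[V_n]` given by the Johnson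
homomorphisms. -/
noncomputable def johnsonLie (n : ℕ) : GrJ n →ₗ⁅ℤ⁆ DerLV n :=
  let F : GrJ n →+ DerLV n := AddMonoidHom.mk' (fun ξ => ⟨johnsonDer ξ, johnsonDer_mem_DerLV ξ⟩)
    fun ξ η => by
      refine Subtype.ext (LieDerivation.ext fun y => lieInl_injective ?_)
      change lieInl n (johnsonDer (ξ + η) y) = lieInl n (johnsonDer ξ y + johnsonDer η y)
      rw [lieInl_johnsonDer, map_add, add_lie, map_add, lieInl_johnsonDer, lieInl_johnsonDer]
  { F.toIntLinearMap with
    map_lie' := by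
      intro ξ η
      refine Subtype.ext (LieDerivation.ext fun y => lieInl_injective ?_)
      change lieInl n (johnsonDer ⁅ξ, η⁆ y) = lieInl n (⁅johnsonDer ξ, johnsonDer η⁆ y)
      rw [LieDerivation.commutator_apply, lieInl_johnsonDer, LieHom.map_lie, map_sub, lie_lie]
      simp only [lieInl_johnsonDer] }

theorem wittMap_johnsonLie_cls (s : ℕ+) (φ : (johnsonFiltration n).sub s) (i : Fin n) :
    wittMap n ((johnsonLie n ((johnsonFiltration n).cls s φ)).1 (FreeLieAlgebra.of ℤ i)) =
      (dcs (Fr n)).cls (s + 1) (johnsonDisplacement φ (FreeGroup.of i)) :=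
  (wittMap_johnsonDer_cls φ (wittHom_of i)).trans
    (CentralFiltration.cls_congr _ (add_comm 1 s) rfl)

end Johnson

/-! ### The subgroups `G(n,m,k-1)` as images of free groups -/

section Factors

variable {n k : ℕ}

/-- The indices `1, …, k - 1`, as elements of `Fin n` shifted by one. -/
abbrev LowIndex (n k : ℕ) : Type := {t : Fin n // (t : ℕ) + 1 ≤ k - 1}

/-- The indices `k, …, n`, as elements of `Fin n` shifted by one. -/
abbrev HighIndex (n k : ℕ) : Type := {m : Fin n // k ≤ (m : ℕ) + 1}

theorem LowIndex.lt (t : LowIndex n k) (m : HighIndex n k) : t.1 < m.1 := by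
  have h1 := t.2
  have h2 := m.2
  exact Fin.lt_def.2 (by omega)

/-- The generator `α_{m,t}` of `G(n,m,k-1)`. -/
def alphaGen (m : HighIndex n k) (t : LowIndex n k) : GSub n m.1 (k - 1) :=
  ⟨⟨alpha m.1 t.1, Subgroup.subset_closure ⟨m.1, t.1, LowIndex.lt t m, rfl⟩⟩,
    Subgroup.subset_closure ⟨t.1, t.2, rfl⟩⟩

/-- The homomorphism from the free group on `x_1, …, x_{k-1}` to `G(n,m,k-1)` which sends `w` to the
automorphism `x_m ↦ w⁻¹ x_m w`. The inverse is needed for multiplicativity. -/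
def freeToGSub (m : HighIndex n k) : FreeGroup (LowIndex n k) →* GSub n m.1 (k - 1) :=
  FreeGroup.lift fun t => (alphaGen m t)⁻¹

theorem freeToGSub_of (m : HighIndex n k) (t : LowIndex n k) :
    ((freeToGSub m (FreeGroup.of t)).1.1 : AutFr n) = (alpha m.1 t.1)⁻¹ := by
  rw [freeToGSub, FreeGroup.lift_apply_of]
  rfl

theorem alpha_inv_of (i j r : Fin n) : (alpha i j)⁻¹ (FreeGroup.of r) =
    if r = i then (FreeGroup.of j)⁻¹ * FreeGroup.of r * FreeGroup.of j else FreeGroup.of r := by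
  have h := conjHom_of i r (FreeGroup.of j)⁻¹
  rw [inv_inv] at h
  exact h

theorem freeToGSub_apply_map (m : HighIndex n k) (w v : FreeGroup (LowIndex n k)) :
    (freeToGSub m w).1.1 (FreeGroup.map Subtype.val v) = FreeGroup.map Subtype.val v := by
  have h : ∀ t : LowIndex n k, ∀ v : FreeGroup (LowIndex n k),
      (alpha m.1 t.1) (FreeGroup.map Subtype.val v) = FreeGroup.map Subtype.val v := by
    intro t v
    have : (alpha m.1 t.1).toMonoidHom.comp (FreeGroup.map Subtype.val) =
        (FreeGroup.map Subtype.val : FreeGroup (LowIndex n k) →* Fr n) := by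
      ext s
      change alpha m.1 t.1 (FreeGroup.map Subtype.val (FreeGroup.of s)) = _
      rw [FreeGroup.map.of, alpha_of, if_neg (LowIndex.lt s m).ne]
    exact DFunLike.congr_fun this v
  induction w using FreeGroup.induction_on generalizing v with
  | C1 => simp
  | of t =>
    rw [freeToGSub_of]
    exact (MulEquiv.symm_apply_eq (alpha m.1 t.1)).2 (h t v).symm
  | inv_of t ih =>
    rw [map_inv]
    exact (MulEquiv.symm_apply_eq (freeToGSub m (FreeGroup.of t)).1.1).2 (ih v).symm
  | mul x y hx hy =>
    rw [map_mul, Subgroup.coe_mul, Subgroup.coe_mul, MulAut.mul_apply, hy, hx]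

theorem freeToGSub_apply_of (m : HighIndex n k) (w : FreeGroup (LowIndex n k)) (r : Fin n) :
    (freeToGSub m w).1.1 (FreeGroup.of r) =
      if r = m.1 then (FreeGroup.map Subtype.val w)⁻¹ * FreeGroup.of r * FreeGroup.map Subtype.val w
      else FreeGroup.of r := by
  induction w using FreeGroup.induction_on with
  | C1 => simp
  | of t => rw [freeToGSub_of, alpha_inv_of, FreeGroup.map.of]
  | inv_of t ih =>
    rw [map_inv, map_inv, FreeGroup.map.of, inv_inv]
    have h : ((freeToGSub m (FreeGroup.of t))⁻¹.1.1 : AutFr n) = alpha m.1 t.1 := by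
      rw [InvMemClass.coe_inv, InvMemClass.coe_inv, freeToGSub_of, inv_inv]
    rw [h, alpha_of]
  | mul x y hx hy =>
    rw [map_mul, Subgroup.coe_mul, Subgroup.coe_mul, MulAut.mul_apply, hy]
    split_ifs with h
    · rw [map_mul, map_mul, map_inv, freeToGSub_apply_map, hx, if_pos h, map_mul, mul_inv_rev]
      simp only [mul_assoc]
    · rw [hx, if_neg h]

theorem freeToGSub_surjective (m : HighIndex n k) : Function.Surjective (freeToGSub m) := by
  rintro ⟨g, hg⟩
  have h : GSub n m.1 (k - 1) ≤ (freeToGSub m).range.map (GSub n m.1 (k - 1)).subtype := by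
    refine (Subgroup.closure_le _).2 ?_
    rintro φ ⟨t, ht, hφ⟩
    have e : φ = (alphaGen m ⟨t, ht⟩).1 := Subtype.ext hφ
    refine ⟨alphaGen m ⟨t, ht⟩, ⟨(FreeGroup.of ⟨t, ht⟩)⁻¹, ?_⟩, e.symm⟩
    rw [map_inv, freeToGSub, FreeGroup.lift_apply_of, inv_inv]
  obtain ⟨_, ⟨w, rfl⟩, hw⟩ := h hg
  exact ⟨w, Subtype.ext hw⟩

/-- The homomorphism from the free group on `x_1, …, x_{k-1}` to the factor `G(n,m,k-1)` of
`H(n,k)`. -/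
def freeToHProd (m : HighIndex n k) : FreeGroup (LowIndex n k) →* HProd n k :=
  (MonoidHom.mulSingle (fun m : HighIndex n k => GSub n m.1 (k - 1)) m).comp (freeToGSub m)

/-- A surjective homomorphism is surjective on the terms of the descending central series. -/
theorem Gam_le_map_of_surjective {G H : Type*} [Group G] [Group H] {f : G →* H}
    (hf : Function.Surjective f) (p : ℕ+) : Gam H p ≤ (Gam G p).map f := by
  induction p using PNat.recOn with
  | one => exact fun h _ => (hf h).imp fun g hg => ⟨Subgroup.mem_top g, hg⟩
  | succ p ih =>
    rw [Gam_succ, Gam_succ, Subgroup.map_commutator, Subgroup.map_top_of_surjective f hf]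
    exact Subgroup.commutator_mono ih le_rfl

/-- The morphism `γ` from `gr^DCS(H(n,k))` to the derivations of `L[V_n]`. -/
noncomputable def hprodDer (n k : ℕ) : GrDCS (HProd n k) →ₗ⁅ℤ⁆ DerLV n :=
  ((johnsonLie n).comp (grDCSMap (johnsonFiltration n) (inclIA n))).comp
    (grDCSMap (dcs (PSigmaPlus n)) (Theta n k))

/-- The inclusion `L[x_1, …, x_{k-1}] → L[V_n]`. -/
noncomputable def lowIncl (n k : ℕ) : FreeLieAlgebra ℤ (LowIndex n k) →ₗ⁅ℤ⁆ LV n :=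
  FreeLieRing.lift fun t => FreeLieAlgebra.of ℤ t.1

/-- The class of the automorphism `x_m ↦ w⁻¹ x_m w` acts on `L[V_n]` as the derivation
`x_m ↦ [x_m, y]`, where `y` corresponds to the class of `w`, and `x_r ↦ 0` for `r ≠ m`. -/
theorem hprodDer_freeToHProd (m : HighIndex n k) (y : FreeLieAlgebra ℤ (LowIndex n k)) (p : ℕ+)
    (w : (dcs (FreeGroup (LowIndex n k))).sub p)
    (hy : wittHom _ y = (dcs (FreeGroup (LowIndex n k))).cls p w) (r : Fin n) :
    (hprodDer n k (grDCSMap (dcs (HProd n k)) (freeToHProd m)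
      ((dcs (FreeGroup (LowIndex n k))).cls p w))).1 (FreeLieAlgebra.of ℤ r) =
      if r = m.1 then ⁅FreeLieAlgebra.of ℤ r, lowIncl n k y⁆ else 0 := by
  apply wittMap_bijective.1
  have hT : Theta n k (freeToHProd m w.1) = (freeToGSub m w.1).1 :=
    Subgroup.noncommPiCoprod_mulSingle (hcomm := GSub_commute n k) m (freeToGSub m w.1)
  have hJ := fun φ => wittMap_johnsonLie_cls (n := n) p φ r
  rw [hprodDer, LieHom.comp_apply, LieHom.comp_apply, grDCSMap, grDCSMap, grDCSMap,
    CentralFiltration.grMap_cls, CentralFiltration.grMap_cls, CentralFiltration.grMap_cls, hJ]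
  have hw : (FreeGroup.map Subtype.val w.1 : Fr n) ∈ (dcs (Fr n)).sub p :=
    map_mem_of_mem_Gam _ _ p _ w.2
  have hd : ∀ φ : (johnsonFiltration n).sub p, φ.1 = inclIA n (Theta n k (freeToHProd m w.1)) →
      ((johnsonDisplacement φ (FreeGroup.of r)).1 : Fr n) =
        if r = m.1 then ⁅(FreeGroup.map Subtype.val w.1 : Fr n)⁻¹, FreeGroup.of r⁆ else 1 := by
    intro φ hφ
    change φ.1.1 (FreeGroup.of r) * (FreeGroup.of r)⁻¹ = _
    rw [hφ, hT]
    change (freeToGSub m w.1).1.1 (FreeGroup.of r) * (FreeGroup.of r)⁻¹ = _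
    rw [freeToGSub_apply_of]
    split_ifs
    · rw [commutatorElement_def, inv_inv]
    · rw [mul_inv_cancel]
  have hd' := hd ⟨_, map_mem_of_mem_Gam _ (inclIA n) p _
    (map_mem_of_mem_Gam (dcs _) (Theta n k) p _ (map_mem_of_mem_Gam _ (freeToHProd m) p _ w.2))⟩ rfl
  split_ifs with h
  · rw [if_pos h] at hd'
    have e : wittMap n (lowIncl n k y) = (dcs (Fr n)).cls p ⟨_, hw⟩ := by
      have := wittHom_map (Subtype.val : LowIndex n k → Fin n) y
      rw [hy, grDCSMap, CentralFiltration.grMap_cls] at this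
      exact this
    have e' : -(dcs (Fr n)).cls p ⟨_, hw⟩ = (dcs (Fr n)).cls p ⟨_, inv_mem hw⟩ := by
      rw [neg_eq_iff_add_eq_zero, ← CentralFiltration.cls_mul, ← CentralFiltration.cls_one _ p]
      congr 1
      exact mul_inv_cancel (⟨_, hw⟩ : (dcs (Fr n)).sub p)
    rw [LieHom.map_lie, e, ← lie_skew, ← neg_lie, e',
      show wittMap n (FreeLieAlgebra.of ℤ r) = _ from wittHom_of r, CentralFiltration.cls_lie]
    exact CentralFiltration.cls_congr _ rfl hd'
  · rw [if_neg h] at hd'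
    rw [map_zero, ← CentralFiltration.cls_one _ (p + 1)]
    exact CentralFiltration.cls_congr _ rfl hd'

end Factors

/-! ### Retracting derivations -/

section Retraction

variable {n k : ℕ}

/-- The embedding of an associative algebra as the upper left corner of the `2 × 2` matrices. -/
noncomputable def cornerLie (A : Type*) [Ring A] : A →ₗ⁅ℤ⁆ Matrix (Fin 2) (Fin 2) A :=
  { (AddMonoidHom.mk' (fun a : A => Matrix.single (0 : Fin 2) (0 : Fin 2) a)
      (Matrix.single_add 0 0)).toIntLinearMap with
    map_lie' := by
      intro a b
      change Matrix.single (0 : Fin 2) (0 : Fin 2) (a * b - b * a) =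
        Matrix.single 0 0 a * Matrix.single 0 0 b - Matrix.single 0 0 b * Matrix.single 0 0 a
      rw [Matrix.single_mul_single_same, Matrix.single_mul_single_same, sub_eq_add_neg,
        sub_eq_add_neg, Matrix.single_add, Matrix.single_neg] }

/-- The morphism from `L[V_n]` to the `2 × 2` matrices over the free associative algebra on
`x_1, …, x_{k-1}` which sends `x_i` to `x_i E₁₁` for `i < k` and to `E₂₁` for `k ≤ i`. -/
noncomputable def matrixLie (n k : ℕ) :
    LV n →ₗ⁅ℤ⁆ Matrix (Fin 2) (Fin 2) (FreeAlgebra ℤ (LowIndex n k)) :=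
  FreeLieRing.lift fun i => if h : (i : ℕ) + 1 ≤ k - 1 then
    Matrix.single 0 0 (FreeAlgebra.ι ℤ ⟨i, h⟩) else Matrix.single 1 0 1

theorem matrixLie_lowIncl (y : FreeLieAlgebra ℤ (LowIndex n k)) :
    matrixLie n k (lowIncl n k y) =
      Matrix.single 0 0 (FreeLieRing.lift (FreeAlgebra.ι ℤ) y) := by
  refine FreeLieRing.hom_congr (f := (matrixLie n k).comp (lowIncl n k))
    (g := (cornerLie _).comp (FreeLieRing.lift (FreeAlgebra.ι ℤ))) (fun t => ?_) y
  rw [LieHom.comp_apply, LieHom.comp_apply, lowIncl, FreeLieRing.lift_of, FreeLieRing.lift_of,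
    matrixLie, FreeLieRing.lift_of, dif_pos t.2]
  rfl

/-- The lower left entry recovers `y` from `[x_m, y]`, because
`[E₂₁, y E₁₁] = y E₂₁`. -/
theorem matrixLie_lie_lowIncl (m : HighIndex n k) (hk : 2 ≤ k)
    (y : FreeLieAlgebra ℤ (LowIndex n k)) :
    matrixLie n k ⁅FreeLieAlgebra.of ℤ m.1, lowIncl n k y⁆ 1 0 =
      FreeLieRing.lift (FreeAlgebra.ι ℤ) y := by
  have hm : ¬ ((m.1 : ℕ) + 1 ≤ k - 1) := by
    have := m.2
    omega
  rw [LieHom.map_lie, matrixLie_lowIncl, matrixLie, FreeLieRing.lift_of, dif_neg hm,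
    LieRing.of_associative_ring_bracket, Matrix.single_mul_single_same,
    Matrix.single_mul_single_of_ne _ _ _ _ (by decide)]
  simp

theorem exists_retraction_hprodDer (hk : 2 ≤ k) :
    ∃ ρ : DerLV n →+ GrDCS (HProd n k), ∀ a, ρ (hprodDer n k a) = a := by
  obtain ⟨r, hr⟩ := FreeLieRing.exists_retraction (LowIndex n k)
  -- the additive map `D ↦ y` with `y = z` if `D x_m = [x_m, z]`
  let coord : HighIndex n k → DerLV n →+ FreeLieAlgebra ℤ (LowIndex n k) := fun m =>
    AddMonoidHom.mk' (fun D => r (matrixLie n k (D.1 (FreeLieAlgebra.of ℤ m.1)) 1 0)) fun D D' => by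
      change r (matrixLie n k (D.1 _ + D'.1 _) 1 0) = _
      rw [map_add, Matrix.add_apply, map_add]
  let ρ : DerLV n →+ GrDCS (HProd n k) := AddMonoidHom.mk' (fun D => ∑ m : HighIndex n k,
    grDCSMap (dcs (HProd n k)) (freeToHProd m) (wittHom _ (coord m D))) fun D D' => by
      simp only [map_add, Finset.sum_add_distrib]
  have hρ : ∀ D, ρ D = ∑ m : HighIndex n k,
    grDCSMap (dcs (HProd n k)) (freeToHProd m) (wittHom _ (coord m D)) := fun D => rfl
  have hfac : ∀ (m : HighIndex n k) (p : ℕ+) (w : (dcs (FreeGroup (LowIndex n k))).sub p),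
      ρ (hprodDer n k (grDCSMap (dcs (HProd n k)) (freeToHProd m)
        ((dcs (FreeGroup (LowIndex n k))).cls p w))) =
      grDCSMap (dcs (HProd n k)) (freeToHProd m) ((dcs (FreeGroup (LowIndex n k))).cls p w) := by
    intro m p w
    obtain ⟨y, hy⟩ := wittHom_surjective ((dcs (FreeGroup (LowIndex n k))).cls p w)
    have hD := hprodDer_freeToHProd m y p w hy
    generalize hprodDer n k (grDCSMap (dcs (HProd n k)) (freeToHProd m)
      ((dcs (FreeGroup (LowIndex n k))).cls p w)) = D at hD ⊢
    rw [hρ, Finset.sum_eq_single m]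
    · have : coord m D = y := by
        change r (matrixLie n k (D.1 (FreeLieAlgebra.of ℤ m.1)) 1 0) = y
        rw [hD, if_pos rfl, matrixLie_lie_lowIncl m hk, hr]
      rw [this, hy]
    · intro m' _ hm
      have : coord m' D = 0 := by
        change r (matrixLie n k (D.1 (FreeLieAlgebra.of ℤ m'.1)) 1 0) = 0
        rw [hD, if_neg fun e => hm (Subtype.ext e), map_zero, Matrix.zero_apply, map_zero]
      rw [this, map_zero, map_zero]
    · exact fun h => absurd (Finset.mem_univ m) h
  refine ⟨ρ, fun a => ?_⟩
  induction a using CentralFiltration.gr_induction with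
  | h0 => rw [map_zero, map_zero]
  | ha a b h h' => rw [map_add, map_add, h, h']
  | hc p h =>
    -- the elements with a fixed class form a subgroup `S` of `Γ^p(H(n,k))`; an element of
    -- `Γ^p(H(n,k))` lies in it because its components do
    let S : Subgroup (HProd n k) :=
      { carrier := {h | ∃ hh : h ∈ (dcs (HProd n k)).sub p,
          ρ (hprodDer n k ((dcs (HProd n k)).cls p ⟨h, hh⟩)) = (dcs (HProd n k)).cls p ⟨h, hh⟩}
        one_mem' := ⟨one_mem _, by
          change ρ (hprodDer n k ((dcs (HProd n k)).cls p 1)) = (dcs (HProd n k)).cls p 1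
          rw [CentralFiltration.cls_one, map_zero, map_zero]⟩
        mul_mem' := by
          rintro g h ⟨hg, eg⟩ ⟨hh, eh⟩
          refine ⟨mul_mem hg hh, ?_⟩
          change ρ (hprodDer n k ((dcs (HProd n k)).cls p (⟨g, hg⟩ * ⟨h, hh⟩))) =
            (dcs (HProd n k)).cls p (⟨g, hg⟩ * ⟨h, hh⟩)
          rw [CentralFiltration.cls_mul, map_add, map_add, eg, eh]
        inv_mem' := by
          rintro g ⟨hg, eg⟩
          refine ⟨inv_mem hg, ?_⟩
          change ρ (hprodDer n k ((dcs (HProd n k)).cls p (⟨g, hg⟩⁻¹))) =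
            (dcs (HProd n k)).cls p (⟨g, hg⟩⁻¹)
          rw [← zpow_neg_one, CentralFiltration.cls_zpow, map_zsmul, map_zsmul, eg] }
    suffices hS : h.1 ∈ S from hS.2
    refine Subgroup.pi_mem_of_mulSingle_mem _ fun m => ?_
    have hm : h.1 m ∈ Gam (GSub n m.1 (k - 1)) p :=
      map_mem_of_mem_Gam (dcs _) (Pi.evalMonoidHom _ m) p _ h.2
    obtain ⟨w, hw, e⟩ := Gam_le_map_of_surjective (freeToGSub_surjective m) p hm
    have := hfac m p ⟨w, hw⟩
    rw [grDCSMap, CentralFiltration.grMap_cls] at this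
    rw [← e]
    exact ⟨_, this⟩

end Retraction

theorem mainTheorem4 (n k : ℕ) (hn : 3 ≤ n) (hk : 2 ≤ k) (hkn : k ≤ n) :
    Function.Bijective (wittMap n) ∧
    ∃ J : GrJ n →ₗ⁅ℤ⁆ DerLV n,
      (∀ (s : ℕ+) (φ : (johnsonFiltration n).sub s) (i : Fin n),
        wittMap n ((J ((johnsonFiltration n).cls s φ)).1 (FreeLieAlgebra.of ℤ i)) =
          (dcs (Fr n)).cls (s + 1) (johnsonDisplacement φ (FreeGroup.of i))) ∧
      ∃ γ : GrDCS (HProd n k) →ₗ⁅ℤ⁆ DerLV n,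
        γ = (J.comp (grDCSMap (johnsonFiltration n) (inclIA n))).comp
          (grDCSMap (dcs (PSigmaPlus n)) (Theta n k)) ∧
        Function.Injective γ ∧
        ∃ ρ : DerLV n →+ GrDCS (HProd n k), ∀ a, ρ (γ a) = a := by
  obtain ⟨ρ, hρ⟩ := exists_retraction_hprodDer (n := n) hk
  exact ⟨wittMap_bijective, johnsonLie n, wittMap_johnsonLie_cls, hprodDer n k, rfl,
    Function.LeftInverse.injective hρ, ρ, hρ⟩
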